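/- Let $n\ge 1$ and $k\ge 0$ be integers, write $[n]=\{1,\dots,n\}$ and let $c=(1\,2\ldots n)\in\mathfrak S_n$; permutations are composed as functions. For $\sigma\in\mathfrak S_n$ let $|\sigma|=n-\ell(\sigma)$, where $\ell(\sigma)$ is the number of cycles of $\sigma$ (fixed points included), and write $\sigma_1\preccurlyeq\sigma_2$ if $|\sigma_2|=|\sigma_1|+|\sigma_1^{-1}\sigma_2|$. Let $\Sigma_n(k)$ be the set of $k$-tuples of transpositions $(\tau_1,\dots,\tau_k)$ in $\mathfrak S_n$ such that $|\tau_1\cdots\tau_k|=k$ and $\tau_1\cdots\tau_k\preccurlyeq c$. *Action.* Write each transposition as $(i\,j)$ with $i<j$. For $1\le l\le k-1$ and $\gamma=((i_1\,j_1),\dots,(i_k\,j_k))$, let $\beta_l\cdot(g_1,\dots,g_k)=(g_1,\dots,g_{l+1},\,g_{l+1}^{-1}g_lg_{l+1},\dots,g_k)$ (positions $l,l+1$ are modified) and set $$\sigma_l\cdot\gamma=\gamma\ \text{ if } i_l=i_{l+1},\qquad \sigma_l\cdot\gamma=\beta_l\cdot\gamma\ \text{ if } i_l<i_{l+1},\qquad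 \sigma_l\cdot\gamma=\beta_l^{-1}\cdot\gamma\ \text{ if } i_l>i_{l+1}.$$ These operations of the Coxeter generators $\sigma_l=(l\ l{+}1)$ extend to an action of $\mathfrak S_k$ on $\Sigma_n(k)$. On sequences, $\mathfrak S_k$ acts by $\sigma\cdot(a_1,\dots,a_k)=(a_{\sigma^{-1}(1)},\dots,a_{\sigma^{-1}(k)})$. *Parking.* For $E=(e_1,\dots,e_k)\in[n]^k$ and $O\subset[n]$ with $|O|=k+1$, define $\Pi(E,O)=(p_1,\dots,p_k)$ by backwards induction on $l=k,\dots,1$: $p_l=c^{r}e_l$, where $r$ is the least $s\in\{1,\dots,n\}$ with $c^{s}e_l\in O\setminus\{p_{l+1},\dots,p_k\}$. Let $\rho(E,O)$ be the unique element of $O\setminus\{p_1,\dots,p_k\}$. *The map.* Let $\binom{[n]}{k+1}$ be the set of $(k+1)$-element subsets of $[n]$. The shift modulo $n$ is the action of $\mathbb Z/n\mathbb Z$ on $[n]^k\times\binom{[n]}{k+1}$ given by applying $c$ to every entry of the sequence and every element of the subset. For $(A,B)\in[n]^k\times\binom{[n]}{k+1}$ put $\tilde A=c^{1-\rho(A,B)}A$,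 $\tilde B=c^{1-\rho(A,B)}B$, let $I=(i_1\le\dots\le i_k)$ be the non-decreasing reordering of $\tilde A$, let $(j_1,\dots,j_k)=\Pi(I,\tilde B)$, choose $\sigma\in\mathfrak S_k$ with $\sigma\cdot\tilde A=I$, and set $$\Gamma_{n,k}(A,B)=\sigma^{-1}\cdot\big((i_1\,j_1),\dots,(i_k\,j_k)\big).$$ **Theorem.** $\Gamma_{n,k}(A,B)$ does not depend on the choice of $\sigma$, and $\Gamma_{n,k}:[n]^k\times\binom{[n]}{k+1}\to\Sigma_n(k)$ is a well-defined surjection whose fibres are exactly the orbits of the shift modulo $n$. In particular the preimage of each element of $\Sigma_n(k)$ has exactly $n$ elements, and $$|\Sigma_n(k)|=n^{k-1}\binom{n}{k+1}.$$ -/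

import Mathlib

namespace CyclePrefix

open Equiv

/-! The set `{1, …, n}` is modelled by `Fin n`, with the label `i + 1` represented by the
element of value `i`; in particular the label `1` is `(0 : Fin n)`, the order is the usual one, and
the `n`-cycle `(1 … n)` is `finRotate n`. Permutations are multiplied as functions,
`(σ * τ) x = σ (τ x)`. -/

/-- The number of cycles of a permutation, trivial cycles included. -/
def numCycles {n : ℕ} (σ : Perm (Fin n)) : ℕ := σ.partition.parts.card

/-- `|σ| = n - ℓ(σ)`. -/
def len {n : ℕ} (σ : Perm (Fin n)) : ℕ := n - numCycles σ

/-- `σ₁ ≼ σ₂` iff `|σ₂| = |σ₁| + |σ₁⁻¹ σ₂|`. -/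
def Below {n : ℕ} (σ₁ σ₂ : Perm (Fin n)) : Prop := len σ₂ = len σ₁ + len (σ₁⁻¹ * σ₂)

/-- The ordered product `τ₁ τ₂ ⋯ τ_k`. -/
def pathProd {n k : ℕ} (γ : Fin k → Perm (Fin n)) : Perm (Fin n) := (List.ofFn γ).prod

/-- `Σ_n(k)`: the `k`-tuples of transpositions `(τ₁, …, τ_k)` with
`|τ₁ ⋯ τ_k| = k` and `τ₁ ⋯ τ_k ≼ (1 … n)`. -/
def prefixes (n k : ℕ) : Set (Fin k → Perm (Fin n)) :=
  {γ | (∀ l, (γ l).IsSwap) ∧ len (pathProd γ) = k ∧ Below (pathProd γ) (finRotate n)}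

/-! ### The action of the symmetric group on paths -/

/-- The smallest element displaced by `τ`; this is `i` if `τ = (i j)` with `i < j`. The value is
irrelevant if `τ = 1`. -/
def low {n : ℕ} [NeZero n] (τ : Perm (Fin n)) : Fin n :=
  if h : τ.support.Nonempty then τ.support.min' h else 0

/-- The position `l` of a pair `(l, l+1)` of neighbouring positions in a `k`-tuple. -/
def fstPos {k : ℕ} (l : Fin (k - 1)) : Fin k := ⟨l, by omega⟩

/-- The position `l + 1` of a pair `(l, l+1)` of neighbouring positions in a `k`-tuple. -/
def sndPos {k : ℕ} (l : Fin (k - 1)) : Fin k := ⟨l + 1, by omega⟩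

/-- The Coxeter generator `σ_l = (l l+1)` of the symmetric group on `k` letters. -/
def coxeterGen {k : ℕ} (l : Fin (k - 1)) : Perm (Fin k) := swap (fstPos l) (sndPos l)

/-- The braid generator `β_l`:
`(g₁, …, g_k) ↦ (g₁, …, g_{l+1}, g_{l+1}⁻¹ g_l g_{l+1}, …, g_k)`. -/
def braid {G : Type*} [Group G] {k : ℕ} (l : Fin (k - 1)) (g : Fin k → G) : Fin k → G :=
  Function.update (Function.update g (fstPos l) (g (sndPos l)))
    (sndPos l) ((g (sndPos l))⁻¹ * g (fstPos l) * g (sndPos l))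

/-- The inverse `β_l⁻¹` of the braid generator:
`(g₁, …, g_k) ↦ (g₁, …, g_l g_{l+1} g_l⁻¹, g_l, …, g_k)`. -/
def braidInv {G : Type*} [Group G] {k : ℕ} (l : Fin (k - 1)) (g : Fin k → G) : Fin k → G :=
  Function.update (Function.update g (fstPos l) (g (fstPos l) * g (sndPos l) * (g (fstPos l))⁻¹))
    (sndPos l) (g (fstPos l))

lemma fstPos_ne_sndPos {k : ℕ} (l : Fin (k - 1)) : fstPos l ≠ sndPos l := by
  simp [fstPos, sndPos, Fin.ext_iff]

lemma braidInv_braid {G : Type*} [Group G] {k : ℕ} (l : Fin (k - 1)) (g : Fin k → G) :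
    braidInv l (braid l g) = g := by
  have h := fstPos_ne_sndPos l
  funext x
  by_cases h1 : x = fstPos l
  · subst h1; simp [braid, braidInv, h, mul_assoc]
  · by_cases h2 : x = sndPos l
    · subst h2; simp [braid, braidInv, h]
    · simp [braid, braidInv, h1, h2]

lemma braid_braidInv {G : Type*} [Group G] {k : ℕ} (l : Fin (k - 1)) (g : Fin k → G) :
    braid l (braidInv l g) = g := by
  have h := fstPos_ne_sndPos l
  funext x
  by_cases h1 : x = fstPos l
  · subst h1; simp [braid, braidInv, h]
  · by_cases h2 : x = sndPos l
    · subst h2; simp [braid, braidInv, h, mul_assoc]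
    · simp [braid, braidInv, h1, h2]

/-- The operation of the Coxeter generator `σ_l` on a path `((i₁ j₁), …, (i_k j_k))`, `i_m < j_m`:
nothing if `i_l = i_{l+1}`, `β_l` if `i_l < i_{l+1}`, and `β_l⁻¹` if `i_l > i_{l+1}`. -/
def genAct {n k : ℕ} [NeZero n] (l : Fin (k - 1)) (γ : Fin k → Perm (Fin n)) :
    Fin k → Perm (Fin n) :=
  if low (γ (fstPos l)) = low (γ (sndPos l)) then γ
  else if low (γ (fstPos l)) < low (γ (sndPos l)) then braid l γ
  else braidInv l γ

/-- Every permutation is a product of Coxeter generators. -/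
lemma exists_word {k : ℕ} (σ : Perm (Fin k)) :
    ∃ w : List (Fin (k - 1)), (w.map coxeterGen).prod = σ := by
  cases k with
  | zero => exact ⟨[], Subsingleton.elim _ _⟩
  | succ m =>
    have hσ : σ ∈ Submonoid.closure
        (Set.range fun i : Fin m => swap i.castSucc i.succ) := by
      rw [Equiv.Perm.mclosure_swap_castSucc_succ]; trivial
    induction hσ using Submonoid.closure_induction with
    | mem x hx =>
      obtain ⟨i, rfl⟩ := hx
      exact ⟨[i], by simp [coxeterGen, fstPos, sndPos, Fin.castSucc, Fin.succ, Fin.castAdd,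
        Fin.castLE]⟩
    | one => exact ⟨[], rfl⟩
    | mul x y _ _ hx hy =>
      obtain ⟨w, rfl⟩ := hx
      obtain ⟨v, rfl⟩ := hy
      exact ⟨w ++ v, by simp⟩

/-- The action of a permutation `σ` on paths: write `σ` as a product of Coxeter generators, and let
these act successively (the rightmost factor first). That this is, on `prefixes n k`, an action of
the symmetric group which extends `genAct` is part of what is claimed about it in the theorem. -/
noncomputable def permAct {n k : ℕ} [NeZero n] (σ : Perm (Fin k)) (γ : Fin k → Perm (Fin n)) :
    Fin k → Perm (Fin n) :=
  (exists_word σ).choose.foldr genAct γ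

/-- The natural action on sequences, `σ · (a₁, …, a_k) = (a_{σ⁻¹(1)}, …, a_{σ⁻¹(k)})`. -/
def permuteSeq {α : Type*} {k : ℕ} (σ : Perm (Fin k)) (A : Fin k → α) : Fin k → α :=
  A ∘ ⇑σ⁻¹

/-! ### The parking process -/

/-- The first element of `O` met when moving along `(1 … n)` from `e`, starting just after `e`:
`(1 … n)^r e` where `r` is the least `s ∈ {1, …, n}` with `(1 … n)^s e ∈ O`. -/
noncomputable def firstOpen {n : ℕ} (O : Finset (Fin n)) (e : Fin n) : Fin n :=
  (finRotate n ^ sInf {s : ℕ | 1 ≤ s ∧ s ≤ n ∧ (finRotate n ^ s) e ∈ O}) e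

/-- The parking process `Π(E, O)`: the last cyclist parks first, and the others then park
one after the other, in decreasing order of their indices, in the spaces that are still free. -/
noncomputable def parking {n : ℕ} : {k : ℕ} → (Fin k → Fin n) → Finset (Fin n) → Fin k → Fin n
  | 0, _, _ => Fin.elim0
  | k + 1, E, O =>
    Fin.snoc (α := fun _ => Fin n)
      (parking (fun l : Fin k => E l.castSucc) (O.erase (firstOpen O (E (Fin.last k)))))
      (firstOpen O (E (Fin.last k)))

/-- The spaces of `O` left vacant by the parking process. -/
noncomputable def vacant {n k : ℕ} (E : Fin k → Fin n) (O : Finset (Fin n)) : Finset (Fin n) :=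
  O \ Finset.univ.image (parking E O)

/-- The residue `ρ(E, O)`: the element of `vacant E O` (there is exactly one when `O` has `k + 1`
elements, see `vacant_eq`). -/
noncomputable def residue {n k : ℕ} [NeZero n] (E : Fin k → Fin n) (O : Finset (Fin n)) : Fin n :=
  if h : (vacant E O).Nonempty then (vacant E O).min' h else 0

lemma firstOpen_mem {n : ℕ} {O : Finset (Fin n)} (hO : O.Nonempty) (e : Fin n) :
    firstOpen O e ∈ O := by
  have hne : {s : ℕ | 1 ≤ s ∧ s ≤ n ∧ (finRotate n ^ s) e ∈ O}.Nonempty := by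
    obtain ⟨o, ho⟩ := hO
    obtain ⟨m, rfl⟩ : ∃ m, n = m + 1 := ⟨n - 1, by have := e.2; omega⟩
    have key : ∀ s : ℕ, ((finRotate (m + 1) ^ s) e).val = (e.val + s) % (m + 1) := by
      intro s
      induction s with
      | zero => simpa using (Nat.mod_eq_of_lt e.2).symm
      | succ s ih =>
        rw [pow_succ', Perm.mul_apply, finRotate_apply, Fin.val_add, ih, Fin.val_one']
        rw [Nat.add_mod_mod, Nat.mod_add_mod, add_assoc]
    have he := e.2
    have ho' := o.2
    by_cases h : e.val < o.val
    · refine ⟨o.val - e.val, by omega, by omega, ?_⟩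
      convert ho
      rw [Fin.ext_iff, key, Nat.add_sub_cancel' h.le, Nat.mod_eq_of_lt ho']
    · refine ⟨o.val + (m + 1) - e.val, by omega, by omega, ?_⟩
      convert ho
      rw [Fin.ext_iff, key, Nat.add_sub_cancel' (by omega), Nat.add_mod_right,
        Nat.mod_eq_of_lt ho']
  exact (Nat.sInf_mem hne).2.2

lemma card_vacant {n k : ℕ} (E : Fin k → Fin n) (O : Finset (Fin n)) (hO : O.card = k + 1) :
    (vacant E O).card = 1 := by
  suffices h : (∀ l, parking E O l ∈ O) ∧ Function.Injective (parking E O) by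
    rw [vacant, Finset.card_sdiff_of_subset
      (by intro x hx; obtain ⟨l, -, rfl⟩ := Finset.mem_image.1 hx; exact h.1 l),
      Finset.card_image_of_injective _ h.2, hO]
    simp
  induction k generalizing O with
  | zero => exact ⟨fun l => l.elim0, fun l => l.elim0⟩
  | succ k ih =>
    have hp := firstOpen_mem (O := O) (Finset.card_pos.1 (by omega)) (E (Fin.last k))
    obtain ⟨h1, h2⟩ := ih (fun l => E l.castSucc) (O.erase (firstOpen O (E (Fin.last k))))
      (by rw [Finset.card_erase_of_mem hp, hO]; rfl)
    constructor
    · intro l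
      induction l using Fin.lastCases with
      | last => simpa [parking] using hp
      | cast l => simpa [parking] using Finset.mem_of_mem_erase (h1 l)
    · rw [parking, Fin.snoc_injective_iff]
      refine ⟨h2, ?_⟩
      rintro ⟨l, hl⟩
      exact Finset.ne_of_mem_erase (h1 l) hl

/-- The residue is the only space left vacant. -/
lemma vacant_eq {n k : ℕ} [NeZero n] (E : Fin k → Fin n) (O : Finset (Fin n))
    (hO : O.card = k + 1) : vacant E O = {residue E O} := by
  obtain ⟨x, hx⟩ := Finset.card_eq_one.1 (card_vacant E O hO)
  simp [residue, hx]

/-! ### The map -/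

/-- The domain `{1, …, n}^k × ({1, …, n} choose k+1)`. -/
abbrev Data (n k : ℕ) : Type := (Fin k → Fin n) × {B : Finset (Fin n) // B.card = k + 1}

/-- The shift modulo `n`, applied `m` times: `(1 … n)^m` acts on the entries of the
sequence and on the elements of the set. -/
def shift {n k : ℕ} (m : ℤ) (x : Data n k) : Data n k :=
  (fun l => (finRotate n ^ m) (x.1 l),
    ⟨x.2.1.map (finRotate n ^ m).toEmbedding, by rw [Finset.card_map]; exact x.2.2⟩)

/-- The pair `(Ã, B̃)`: `(A, B)` shifted by `(1 … n)^(1 - ρ(A, B))`. As the value of an element of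
`Fin n` is its label minus one, the exponent `1 - ρ` is minus the value of the residue. -/
noncomputable def normalize {n k : ℕ} [NeZero n] (x : Data n k) : Data n k :=
  shift (-((residue x.1 x.2.1 : Fin n) : ℤ)) x

/-- The non-decreasing reordering `I` of `Ã`. -/
noncomputable def sorted {n k : ℕ} [NeZero n] (x : Data n k) : Fin k → Fin n :=
  (normalize x).1 ∘ ⇑(Tuple.sort (normalize x).1)

/-- The path `((i₁ j₁), …, (i_k j_k))`, where `J = Π(I, B̃)`. -/
noncomputable def sortedPath {n k : ℕ} [NeZero n] (x : Data n k) : Fin k → Perm (Fin n) :=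
  fun l => swap (sorted x l) (parking (sorted x) (normalize x).2.1 l)

/-- The map `Γ_{n,k}`: the path `σ⁻¹ · ((i₁ j₁), …, (i_k j_k))`, where `σ` is a permutation with
`σ · Ã = I`; the one chosen here is the inverse of `Tuple.sort Ã`. -/
noncomputable def Gamma {n k : ℕ} [NeZero n] (x : Data n k) : Fin k → Perm (Fin n) :=
  permAct (Tuple.sort (normalize x).1) (sortedPath x)

end CyclePrefix

namespace CyclePrefix

open Equiv

/-! ### Transpositions and their smallest displaced element -/

/-! The proof separates the smaller ends of the transpositions, which the symmetric group merely
permutes, from the larger ends, which parking recovers.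

The action. A generator preserves the product and exchanges the smaller ends of two neighbours,
since conjugating by a transposition that moves only elements larger than the smaller end of another
does not change that end (`low_conj`). The Coxeter relations are never checked: an insertion sort of
paths is invariant under every generator (`sortLow_genAct`) and is injective on paths of
transpositions with a prescribed sequence of smaller ends (`sortLow_inj`). So the result of a word
is determined by its sequence of smaller ends (`foldr_genAct_eq`). This yields both the action and
the independence of the choice of `σ`.

Sorted paths. A tuple of transpositions lies in `Σ_n(k)` iff multiplying the long cycle on the left
by `τ₁`, then `τ₂`, and so on, splits a cycle every time (`mem_prefixes_iff`). When the smaller ends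
are non-decreasing this becomes a condition on pairs: the intervals `[i, j)` are disjoint or
suitably nested (`mem_prefixes_iff_nested`).

Parking. If the residue is `0`, nobody rides past the end of the street, so each cyclist takes the
first free space to the right; this is the same condition on pairs (`ParksLinearly.nested`,
`parksLinearly_of_nested`). Whether the residue is `0` depends only on the multiset of starting
points (`residue_eq_zero_iff`), so sorting `Ã` is harmless. Thus pairs with residue `0` correspond
bijectively to `Σ_n(k)`: the smaller ends give `Ã`, and the larger ends of the sorted path, together
with `0`, give `B̃`. The shift moves the residue along the cycle, so each orbit has `n` elements and
contains exactly one pair with residue `0`. -/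

lemma low_swap {n : ℕ} [NeZero n] {a b : Fin n} (h : a < b) : low (swap a b) = a := by
  have hs : (swap a b).support = {a, b} := Perm.support_swap h.ne
  have hne : (swap a b).support.Nonempty := by rw [hs]; exact ⟨a, by simp⟩
  rw [low, dif_pos hne]
  apply le_antisymm
  · exact Finset.min'_le _ _ (by rw [hs]; simp)
  · refine Finset.le_min' _ _ _ fun y hy => ?_
    rw [hs, Finset.mem_insert, Finset.mem_singleton] at hy
    rcases hy with rfl | rfl
    · exact le_rfl
    · exact h.le

lemma exists_lt_of_isSwap {n : ℕ} {τ : Perm (Fin n)} (h : τ.IsSwap) :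
    ∃ a b, a < b ∧ τ = swap a b := by
  obtain ⟨a, b, hab, rfl⟩ := h
  rcases lt_or_gt_of_ne hab with h | h
  · exact ⟨a, b, h, rfl⟩
  · exact ⟨b, a, h, swap_comm a b⟩

lemma isSwap_conj {α : Type*} [DecidableEq α] {τ : Perm α} (h : τ.IsSwap) (g : Perm α) :
    (g * τ * g⁻¹).IsSwap := by
  obtain ⟨a, b, hab, rfl⟩ := h
  exact ⟨g a, g b, fun h => hab (g.injective h), (swap_apply_apply g a b).symm⟩

lemma inv_eq_of_isSwap {α : Type*} [DecidableEq α] {τ : Perm α} (h : τ.IsSwap) : τ⁻¹ = τ := by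
  obtain ⟨a, b, -, rfl⟩ := h
  exact swap_inv a b

lemma isSwap_conj_inv {α : Type*} [DecidableEq α] {τ : Perm α} (h : τ.IsSwap) (g : Perm α) :
    (g⁻¹ * τ * g).IsSwap := by
  simpa using isSwap_conj h g⁻¹

/-- `g` fixes everything below `low g`, hence `low h`, and it cannot send the other end of `h` below
`low h`. -/
lemma low_conj {n : ℕ} [NeZero n] {g h : Perm (Fin n)} (hg : g.IsSwap) (hh : h.IsSwap)
    (hlt : low h < low g) : low (g * h * g⁻¹) = low h := by
  obtain ⟨a, b, hab, rfl⟩ := exists_lt_of_isSwap hh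
  obtain ⟨c, d, hcd, rfl⟩ := exists_lt_of_isSwap hg
  rw [low_swap hab, low_swap hcd] at hlt
  rw [← swap_apply_apply, low_swap hab, swap_apply_of_ne_of_ne hlt.ne (hlt.trans hcd).ne]
  apply low_swap
  rw [swap_apply_def]
  split_ifs with h1 h2
  · exact hlt.trans hcd
  · exact hlt
  · exact hab

lemma low_conj_inv {n : ℕ} [NeZero n] {g h : Perm (Fin n)} (hg : g.IsSwap) (hh : h.IsSwap)
    (hlt : low h < low g) : low (g⁻¹ * h * g) = low h := by
  have := low_conj hg hh hlt
  rwa [inv_eq_of_isSwap hg] at *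

/-! ### The generators acting on lists -/

/-- The effect of a Coxeter generator on two neighbouring entries of a path. -/
def pairAct {n : ℕ} [NeZero n] (a b : Perm (Fin n)) : Perm (Fin n) × Perm (Fin n) :=
  if low a = low b then (a, b)
  else if low a < low b then (b, b⁻¹ * a * b)
  else (a * b * a⁻¹, a)

lemma pairAct_isSwap {n : ℕ} [NeZero n] {a b : Perm (Fin n)} (ha : a.IsSwap) (hb : b.IsSwap) :
    (pairAct a b).1.IsSwap ∧ (pairAct a b).2.IsSwap := by
  unfold pairAct
  split_ifs
  · exact ⟨ha, hb⟩
  · exact ⟨hb, isSwap_conj_inv ha b⟩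
  · exact ⟨isSwap_conj hb a, ha⟩

lemma pairAct_mul {n : ℕ} [NeZero n] (a b : Perm (Fin n)) :
    (pairAct a b).1 * (pairAct a b).2 = a * b := by
  unfold pairAct
  split_ifs <;> simp [mul_assoc]

lemma low_pairAct {n : ℕ} [NeZero n] {a b : Perm (Fin n)} (ha : a.IsSwap) (hb : b.IsSwap) :
    low (pairAct a b).1 = low b ∧ low (pairAct a b).2 = low a := by
  unfold pairAct
  split_ifs with h1 h2
  · exact ⟨h1, h1.symm⟩
  · exact ⟨rfl, low_conj_inv hb ha h2⟩
  · exact ⟨low_conj ha hb (lt_of_le_of_ne (not_lt.1 h2) (Ne.symm h1)), rfl⟩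

lemma genAct_eq_update {n k : ℕ} [NeZero n] (l : Fin (k - 1)) (γ : Fin k → Perm (Fin n)) :
    genAct l γ = Function.update (Function.update γ (fstPos l)
      (pairAct (γ (fstPos l)) (γ (sndPos l))).1) (sndPos l)
      (pairAct (γ (fstPos l)) (γ (sndPos l))).2 := by
  unfold genAct pairAct braid braidInv
  split_ifs <;> simp

lemma ofFn_update_update {α : Type*} {k : ℕ} (l : Fin (k - 1)) (g : Fin k → α) (a b : α) :
    List.ofFn (Function.update (Function.update g (fstPos l) a) (sndPos l) b) =
      (List.ofFn g).take l ++ a :: b :: (List.ofFn g).drop (l + 2) := by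
  have hl := l.2
  apply List.ext_getElem
  · simp; omega
  · intro i h1 h2
    simp only [List.length_ofFn] at h1
    simp only [List.getElem_ofFn, Function.update_apply, fstPos, sndPos, Fin.ext_iff,
      List.getElem_append, List.length_take, List.length_ofFn, List.getElem_cons,
      List.getElem_take, List.getElem_drop]
    split_ifs <;> first | rfl | omega | skip
    congr 2; omega

lemma ofFn_genAct {n k : ℕ} [NeZero n] (l : Fin (k - 1)) (γ : Fin k → Perm (Fin n)) :
    ∃ L M : List (Perm (Fin n)),
      List.ofFn γ = L ++ γ (fstPos l) :: γ (sndPos l) :: M ∧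
      List.ofFn (genAct l γ) = L ++ (pairAct (γ (fstPos l)) (γ (sndPos l))).1 ::
        (pairAct (γ (fstPos l)) (γ (sndPos l))).2 :: M := by
  refine ⟨_, _, ?_, by rw [genAct_eq_update]; exact ofFn_update_update l γ _ _⟩
  rw [← ofFn_update_update]
  simp

lemma genAct_isSwap {n k : ℕ} [NeZero n] (l : Fin (k - 1)) {γ : Fin k → Perm (Fin n)}
    (h : ∀ i, (γ i).IsSwap) (i : Fin k) : (genAct l γ i).IsSwap := by
  rw [genAct_eq_update, Function.update_apply, Function.update_apply]
  have := pairAct_isSwap (h (fstPos l)) (h (sndPos l))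
  split_ifs
  exacts [this.2, this.1, h i]

lemma low_genAct {n k : ℕ} [NeZero n] (l : Fin (k - 1)) {γ : Fin k → Perm (Fin n)}
    (h : ∀ i, (γ i).IsSwap) (i : Fin k) : low (genAct l γ i) = low (γ (coxeterGen l i)) := by
  have := low_pairAct (h (fstPos l)) (h (sndPos l))
  rw [genAct_eq_update, Function.update_apply, Function.update_apply, coxeterGen, swap_apply_def]
  have hne := fstPos_ne_sndPos l
  split_ifs <;> simp_all

lemma pathProd_genAct {n k : ℕ} [NeZero n] (l : Fin (k - 1)) (γ : Fin k → Perm (Fin n)) :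
    pathProd (genAct l γ) = pathProd γ := by
  obtain ⟨L, M, h1, h2⟩ := ofFn_genAct l γ
  rw [pathProd, pathProd, h1, h2]
  simp only [List.prod_append, List.prod_cons, ← mul_assoc]
  rw [mul_assoc L.prod, pairAct_mul, ← mul_assoc]

lemma genAct_mem {n k : ℕ} [NeZero n] (l : Fin (k - 1)) {γ : Fin k → Perm (Fin n)}
    (h : γ ∈ prefixes n k) : genAct l γ ∈ prefixes n k := by
  refine ⟨genAct_isSwap l h.1, ?_⟩
  rw [pathProd_genAct]
  exact h.2

/-! ### Insertion sort of paths -/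

/-- Insert `g` at the front of a path and move it to the right past all entries with smaller `low`,
which get conjugated by `g`. -/
def insertLow {n : ℕ} [NeZero n] (g : Perm (Fin n)) : List (Perm (Fin n)) → List (Perm (Fin n))
  | [] => [g]
  | r :: R => if low g ≤ low r then g :: r :: R else g * r * g⁻¹ :: insertLow g R

/-- Insertion sort of a path with respect to `low`. -/
def sortLow {n : ℕ} [NeZero n] (L : List (Perm (Fin n))) : List (Perm (Fin n)) :=
  L.foldr insertLow []

lemma insertLow_isSwap {n : ℕ} [NeZero n] {g : Perm (Fin n)} (hg : g.IsSwap)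
    {R : List (Perm (Fin n))} (hR : ∀ r ∈ R, r.IsSwap) : ∀ r ∈ insertLow g R, r.IsSwap := by
  induction R with
  | nil => simpa [insertLow] using hg
  | cons r R ih =>
    rw [List.forall_mem_cons] at hR
    unfold insertLow
    split_ifs
    · simpa using ⟨hg, hR.1, hR.2⟩
    · rw [List.forall_mem_cons]
      exact ⟨isSwap_conj hR.1 g, ih hR.2⟩

lemma sortLow_isSwap {n : ℕ} [NeZero n] {L : List (Perm (Fin n))} (hL : ∀ r ∈ L, r.IsSwap) :
    ∀ r ∈ sortLow L, r.IsSwap := by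
  induction L with
  | nil => simp [sortLow]
  | cons g L ih =>
    rw [List.forall_mem_cons] at hL
    exact insertLow_isSwap hL.1 (ih hL.2)

/-- The relation behind the invariance of sorting. An entry smaller than both is conjugated by `b *
(b⁻¹ * a * b) = a * b` in either order. At the first entry `r` with `low a ≤ low r`, the
transposition `b⁻¹ * a * b` stops; `b` then passes it, turns it back into `a`, and continues exactly
as if it had been inserted first. -/
lemma insertLow_insertLow {n : ℕ} [NeZero n] {a b : Perm (Fin n)} (ha : a.IsSwap) (hb : b.IsSwap)
    (hab : low a < low b) {R : List (Perm (Fin n))} (hR : ∀ r ∈ R, r.IsSwap) :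
    insertLow b (insertLow (b⁻¹ * a * b) R) = insertLow a (insertLow b R) := by
  have hl := low_conj_inv hb ha hab
  have hl' : ¬ low b ≤ low (b⁻¹ * a * b) := by rw [hl]; exact not_le.2 hab
  have hc : b * (b⁻¹ * a * b) * b⁻¹ = a := by group
  induction R with
  | nil =>
    simp only [insertLow]
    rw [if_neg hl', if_pos hab.le, hc]
  | cons r R ih =>
    rw [List.forall_mem_cons] at hR
    rcases lt_or_ge (low r) (low a) with h1 | h1
    · have h2 := h1.trans hab
      rw [insertLow, if_neg (by rw [hl]; exact not_le.2 h1), insertLow, if_neg, ih hR.2]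
      · conv_rhs => rw [insertLow, if_neg (not_le.2 h2), insertLow,
          if_neg (by rw [low_conj hb hR.1 h2]; exact not_le.2 h1)]
        congr 1
        group
      · rw [low_conj _ hR.1 (by rwa [hl])]
        · exact not_le.2 h2
        · exact isSwap_conj_inv ha b
    · rw [insertLow, if_pos (by rwa [hl]), insertLow, if_neg hl', hc]
      rcases lt_or_ge (low r) (low b) with h2 | h2
      · rw [insertLow, if_neg (not_le.2 h2), insertLow,
          if_pos (by rwa [low_conj hb hR.1 h2])]
      · rw [insertLow, if_pos h2, insertLow, if_pos hab.le]

lemma insertLow_pairAct {n : ℕ} [NeZero n] {a b : Perm (Fin n)} (ha : a.IsSwap) (hb : b.IsSwap)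
    {R : List (Perm (Fin n))} (hR : ∀ r ∈ R, r.IsSwap) :
    insertLow (pairAct a b).1 (insertLow (pairAct a b).2 R) = insertLow a (insertLow b R) := by
  unfold pairAct
  split_ifs with h1 h2
  · rfl
  · exact insertLow_insertLow ha hb h2 hR
  · have h3 := lt_of_le_of_ne (not_lt.1 h2) (Ne.symm h1)
    -- The case of `β_l⁻¹` is the previous one for the pair `(a * b * a⁻¹, a)`, read backwards.
    have := insertLow_insertLow (isSwap_conj hb a) ha (by rwa [low_conj ha hb h3]) hR
    rw [← this]
    congr 2
    group

lemma sortLow_genAct {n k : ℕ} [NeZero n] (l : Fin (k - 1)) {γ : Fin k → Perm (Fin n)}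
    (h : ∀ i, (γ i).IsSwap) : sortLow (List.ofFn (genAct l γ)) = sortLow (List.ofFn γ) := by
  obtain ⟨L, M, h1, h2⟩ := ofFn_genAct l γ
  have hM : ∀ r ∈ M, r.IsSwap := by
    intro r hr
    have : r ∈ List.ofFn γ := by rw [h1]; simp [hr]
    obtain ⟨i, rfl⟩ := List.mem_ofFn.1 this
    exact h i
  rw [h1, h2, sortLow, sortLow, List.foldr_append, List.foldr_append]
  congr 1
  exact insertLow_pairAct (h _) (h _) (sortLow_isSwap hM)

lemma map_low_insertLow {n : ℕ} [NeZero n] {a a' : Perm (Fin n)} (ha : a.IsSwap)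
    (ha' : a'.IsSwap) (hl : low a = low a') {R R' : List (Perm (Fin n))}
    (hR : ∀ r ∈ R, r.IsSwap) (hR' : ∀ r ∈ R', r.IsSwap) (h : R.map low = R'.map low) :
    (insertLow a R).map low = (insertLow a' R').map low := by
  induction R generalizing R' with
  | nil =>
    obtain rfl : R' = [] := by simpa using h.symm
    simpa [insertLow] using hl
  | cons r R ih =>
    cases R' with
    | nil => simp at h
    | cons r' R' =>
      rw [List.map_cons, List.map_cons, List.cons.injEq] at h
      rw [List.forall_mem_cons] at hR hR'
      unfold insertLow
      by_cases h1 : low a ≤ low r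
      · rw [if_pos h1, if_pos (by rw [← hl, ← h.1]; exact h1)]
        simp [hl, h.1, h.2]
      · have h1' : ¬ low a' ≤ low r' := by rw [← hl, ← h.1]; exact h1
        rw [if_neg h1, if_neg h1', List.map_cons, List.map_cons, ih hR.2 hR'.2 h.2,
          low_conj ha hR.1 (not_le.1 h1), low_conj ha' hR'.1 (not_le.1 h1'), h.1]

/-- The place where the inserted transposition stops depends only on the smaller ends. So it is the
same on both sides, the transposition can be read off there, and the conjugations can be undone. -/
lemma insertLow_inj {n : ℕ} [NeZero n] {a a' : Perm (Fin n)} (hl : low a = low a')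
    {R R' : List (Perm (Fin n))} (h : R.map low = R'.map low)
    (hi : insertLow a R = insertLow a' R') : a = a' ∧ R = R' := by
  induction R generalizing R' with
  | nil =>
    obtain rfl : R' = [] := by simpa using h.symm
    simpa [insertLow] using hi
  | cons r R ih =>
    cases R' with
    | nil => simp at h
    | cons r' R' =>
      rw [List.map_cons, List.map_cons, List.cons.injEq] at h
      unfold insertLow at hi
      by_cases h1 : low a ≤ low r
      · rw [if_pos h1, if_pos (by rw [← hl, ← h.1]; exact h1)] at hi
        simpa using hi
      · rw [if_neg h1, if_neg (by rw [← hl, ← h.1]; exact h1), List.cons.injEq] at hi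
        obtain ⟨rfl, rfl⟩ := ih h.2 hi.2
        simpa using hi.1

lemma sortLow_inj {n : ℕ} [NeZero n] {L L' : List (Perm (Fin n))}
    (hL : ∀ r ∈ L, r.IsSwap) (hL' : ∀ r ∈ L', r.IsSwap) (h : L.map low = L'.map low) :
    (sortLow L).map low = (sortLow L').map low ∧ (sortLow L = sortLow L' → L = L') := by
  induction L generalizing L' with
  | nil =>
    obtain rfl : L' = [] := by simpa using h.symm
    simp
  | cons g L ih =>
    cases L' with
    | nil => simp at h
    | cons g' L' =>
      rw [List.map_cons, List.map_cons, List.cons.injEq] at h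
      rw [List.forall_mem_cons] at hL hL'
      obtain ⟨h1, h2⟩ := ih hL.2 hL'.2 h.2
      refine ⟨map_low_insertLow hL.1 hL'.1 h.1 (sortLow_isSwap hL.2) (sortLow_isSwap hL'.2) h1,
        fun hs => ?_⟩
      obtain ⟨rfl, h3⟩ := insertLow_inj h.1 h1 hs
      rw [h2 h3]

/-! ### The action of the symmetric group -/

lemma foldr_genAct_isSwap {n k : ℕ} [NeZero n] (w : List (Fin (k - 1)))
    {γ : Fin k → Perm (Fin n)} (h : ∀ i, (γ i).IsSwap) (i : Fin k) :
    (w.foldr genAct γ i).IsSwap := by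
  induction w generalizing i with
  | nil => exact h i
  | cons l w ih => exact genAct_isSwap l ih i

lemma low_foldr_genAct {n k : ℕ} [NeZero n] (w : List (Fin (k - 1)))
    {γ : Fin k → Perm (Fin n)} (h : ∀ i, (γ i).IsSwap) (i : Fin k) :
    low (w.foldr genAct γ i) = low (γ ((w.map coxeterGen).prod⁻¹ i)) := by
  induction w generalizing i with
  | nil => simp
  | cons l w ih =>
    rw [List.foldr_cons, low_genAct l (foldr_genAct_isSwap w h), ih]
    simp [coxeterGen]

lemma sortLow_foldr_genAct {n k : ℕ} [NeZero n] (w : List (Fin (k - 1)))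
    {γ : Fin k → Perm (Fin n)} (h : ∀ i, (γ i).IsSwap) :
    sortLow (List.ofFn (w.foldr genAct γ)) = sortLow (List.ofFn γ) := by
  induction w with
  | nil => rfl
  | cons l w ih => rw [List.foldr_cons, sortLow_genAct l (foldr_genAct_isSwap w h), ih]

/-- The action of a word on a path of transpositions depends only on the sequence of smallest
displaced elements of the outcome. -/
lemma foldr_genAct_eq {n k : ℕ} [NeZero n] (w v : List (Fin (k - 1)))
    {γ : Fin k → Perm (Fin n)} (h : ∀ i, (γ i).IsSwap)
    (hl : ∀ i, low (w.foldr genAct γ i) = low (v.foldr genAct γ i)) :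
    w.foldr genAct γ = v.foldr genAct γ := by
  apply List.ofFn_injective
  refine (sortLow_inj ?_ ?_ ?_).2 ?_
  · intro r hr
    obtain ⟨i, rfl⟩ := List.mem_ofFn.1 hr
    exact foldr_genAct_isSwap w h i
  · intro r hr
    obtain ⟨i, rfl⟩ := List.mem_ofFn.1 hr
    exact foldr_genAct_isSwap v h i
  · rw [List.map_ofFn, List.map_ofFn]
    exact congrArg _ (funext hl)
  · rw [sortLow_foldr_genAct w h, sortLow_foldr_genAct v h]

lemma permAct_isSwap {n k : ℕ} [NeZero n] (σ : Perm (Fin k)) {γ : Fin k → Perm (Fin n)}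
    (h : ∀ i, (γ i).IsSwap) (i : Fin k) : (permAct σ γ i).IsSwap :=
  foldr_genAct_isSwap _ h i

lemma low_permAct {n k : ℕ} [NeZero n] (σ : Perm (Fin k)) {γ : Fin k → Perm (Fin n)}
    (h : ∀ i, (γ i).IsSwap) (i : Fin k) : low (permAct σ γ i) = low (γ (σ⁻¹ i)) := by
  rw [permAct, low_foldr_genAct _ h, (exists_word σ).choose_spec]

/-- Frees `permAct` from its chosen word: any word producing the right smaller ends will do. The
axioms of an action follow by comparing smaller ends. -/
lemma permAct_eq_foldr {n k : ℕ} [NeZero n] (σ : Perm (Fin k)) (w : List (Fin (k - 1)))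
    {γ : Fin k → Perm (Fin n)} (h : ∀ i, (γ i).IsSwap)
    (hl : ∀ i, low (γ (σ⁻¹ i)) = low (w.foldr genAct γ i)) :
    permAct σ γ = w.foldr genAct γ :=
  foldr_genAct_eq _ w h fun i => (low_permAct σ h i).trans (hl i)

lemma permAct_congr {n k : ℕ} [NeZero n] {σ τ : Perm (Fin k)} {γ : Fin k → Perm (Fin n)}
    (h : ∀ i, (γ i).IsSwap) (hl : ∀ i, low (γ (σ⁻¹ i)) = low (γ (τ⁻¹ i))) :
    permAct σ γ = permAct τ γ :=
  permAct_eq_foldr σ _ h fun i => (hl i).trans (low_permAct τ h i).symm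

lemma permAct_one {n k : ℕ} [NeZero n] {γ : Fin k → Perm (Fin n)} (h : ∀ i, (γ i).IsSwap) :
    permAct 1 γ = γ :=
  permAct_eq_foldr 1 [] h fun _ => rfl

lemma permAct_coxeterGen {n k : ℕ} [NeZero n] (l : Fin (k - 1)) {γ : Fin k → Perm (Fin n)}
    (h : ∀ i, (γ i).IsSwap) : permAct (coxeterGen l) γ = genAct l γ :=
  permAct_eq_foldr _ [l] h fun i => by simp [low_genAct l h, coxeterGen]

lemma permAct_mul {n k : ℕ} [NeZero n] (σ τ : Perm (Fin k)) {γ : Fin k → Perm (Fin n)}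
    (h : ∀ i, (γ i).IsSwap) : permAct (σ * τ) γ = permAct σ (permAct τ γ) := by
  have : permAct σ (permAct τ γ) =
      ((exists_word σ).choose ++ (exists_word τ).choose).foldr genAct γ := by
    rw [List.foldr_append]; rfl
  rw [this]
  refine permAct_eq_foldr _ _ h fun i => ?_
  rw [← this, low_permAct σ (permAct_isSwap τ h), low_permAct τ h]
  simp

lemma permAct_mem {n k : ℕ} [NeZero n] (σ : Perm (Fin k)) {γ : Fin k → Perm (Fin n)}
    (h : γ ∈ prefixes n k) : permAct σ γ ∈ prefixes n k := by
  unfold permAct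
  induction (exists_word σ).choose with
  | nil => exact h
  | cons l w ih => exact genAct_mem l ih

/-! ### Counting cycles -/

lemma numCycles_add_card_support {n : ℕ} (σ : Perm (Fin n)) :
    numCycles σ = σ.cycleType.card + (n - σ.support.card) := by
  simp [numCycles, Perm.parts_partition]

lemma numCycles_eq_card_quotient {n : ℕ} (σ : Perm (Fin n)) :
    numCycles σ = Nat.card (Quotient (Perm.SameCycle.setoid σ)) := by
  classical
  -- `F` labels each orbit: a fixed point by itself, any other point by its cycle.
  let F : Fin n → Perm (Fin n) ⊕ Fin n := fun x =>
    if σ x = x then Sum.inr x else Sum.inl (σ.cycleOf x)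
  have hker : Perm.SameCycle.setoid σ = Setoid.ker F := by
    ext x y
    change σ.SameCycle x y ↔ F x = F y
    by_cases hx : σ x = x
    · by_cases hy : σ y = y
      · simp only [F, hx, hy, if_true, Sum.inr.injEq]
        exact ⟨fun h => h.eq_of_left hx, fun h => h ▸ Perm.SameCycle.rfl⟩
      · simp only [F, hx, hy, if_true, if_false, reduceCtorEq, iff_false]
        exact fun h => hy (h.apply_eq_self_iff.1 hx)
    · by_cases hy : σ y = y
      · simp only [F, hx, hy, if_true, if_false, reduceCtorEq, iff_false]
        exact fun h => hx (h.apply_eq_self_iff.2 hy)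
      · simp only [F, hx, hy, if_false, Sum.inl.injEq]
        exact Perm.sameCycle_iff_cycleOf_eq_of_mem_support (by simpa using hx) (by simpa using hy)
  have hrange : Set.range F = ↑(σ.cycleFactorsFinset.disjSum σ.supportᶜ) := by
    ext z
    rw [Finset.mem_coe]
    rcases z with c | x
    · rw [Finset.inl_mem_disjSum]
      constructor
      · rintro ⟨x, hx⟩
        by_cases h : σ x = x
        · simp [F, h] at hx
        · simp only [F, h, if_false, Sum.inl.injEq] at hx
          rw [← hx, Perm.cycleOf_mem_cycleFactorsFinset_iff]
          simpa using h
      · intro hc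
        obtain ⟨x, hx⟩ := (Perm.mem_cycleFactorsFinset_iff.1 hc).1.nonempty_support
        have hxσ : x ∈ σ.support := Perm.mem_cycleFactorsFinset_support_le hc hx
        refine ⟨x, ?_⟩
        have h : σ x ≠ x := by simpa using hxσ
        simp only [F, h, if_false, Sum.inl.injEq]
        exact (Perm.cycle_is_cycleOf hx hc).symm
    · rw [Finset.inr_mem_disjSum, Finset.mem_compl, Perm.mem_support, not_not]
      constructor
      · rintro ⟨y, hy⟩
        by_cases h : σ y = y
        · simp only [F, h, if_true, Sum.inr.injEq] at hy
          rwa [← hy]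
        · simp [F, h] at hy
      · intro h
        exact ⟨x, by simp [F, h]⟩
  rw [hker, Nat.card_congr (Setoid.quotientKerEquivRange F), hrange, Nat.card_coe_set_eq,
    Set.ncard_coe_finset, Finset.card_disjSum, numCycles_add_card_support, Finset.card_compl,
    Fintype.card_fin, Perm.cycleType_def, Multiset.card_map]
  rfl

lemma numCycles_one (n : ℕ) : numCycles (1 : Perm (Fin n)) = n := by
  simp [numCycles_add_card_support]

lemma numCycles_le {n : ℕ} (σ : Perm (Fin n)) : numCycles σ ≤ n := by
  rw [numCycles_eq_card_quotient]
  simpa using Nat.card_le_card_of_surjective _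
    (Quotient.mk_surjective (s := Perm.SameCycle.setoid σ))

lemma sign_eq_pow_numCycles {n : ℕ} (σ : Perm (Fin n)) :
    Perm.sign σ = (-1) ^ (n + numCycles σ) := by
  have h1 : σ.support.card ≤ n := by simpa using Finset.card_le_univ σ.support
  rw [Perm.sign_of_cycleType, numCycles_add_card_support, Perm.sum_cycleType]
  have h2 : n + (σ.cycleType.card + (n - σ.support.card)) =
      (σ.support.card + σ.cycleType.card) + 2 * (n - σ.support.card) := by omega
  rw [h2, pow_add _ _ (2 * _), pow_mul]
  simp

/-- The coarsening of an equivalence relation which identifies the classes of `a` and `b`. -/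
def joinPair {α : Type*} (r : Setoid α) (a b : α) : Setoid α where
  r x y := r x y ∨ (r x a ∧ r b y) ∨ (r x b ∧ r a y)
  iseqv := by
    constructor
    · exact fun x => Or.inl (r.refl x)
    · rintro x y (h | ⟨h1, h2⟩ | ⟨h1, h2⟩)
      · exact Or.inl (r.symm h)
      · exact Or.inr (Or.inr ⟨r.symm h2, r.symm h1⟩)
      · exact Or.inr (Or.inl ⟨r.symm h2, r.symm h1⟩)
    · rintro x y z (h | ⟨h1, h2⟩ | ⟨h1, h2⟩) (h' | ⟨h3, h4⟩ | ⟨h3, h4⟩)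
      · exact Or.inl (r.trans h h')
      · exact Or.inr (Or.inl ⟨r.trans h h3, h4⟩)
      · exact Or.inr (Or.inr ⟨r.trans h h3, h4⟩)
      · exact Or.inr (Or.inl ⟨h1, r.trans h2 h'⟩)
      · exact Or.inr (Or.inl ⟨h1, h4⟩)
      · exact Or.inl (r.trans h1 h4)
      · exact Or.inr (Or.inr ⟨h1, r.trans h2 h'⟩)
      · exact Or.inl (r.trans h1 h4)
      · exact Or.inr (Or.inr ⟨h1, h4⟩)

lemma joinPair_eq_self {α : Type*} {r : Setoid α} {a b : α} (h : r a b) : joinPair r a b = r := by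
  ext x y
  refine ⟨?_, Or.inl⟩
  rintro (h' | ⟨h1, h2⟩ | ⟨h1, h2⟩)
  · exact h'
  · exact r.trans (r.trans h1 h) h2
  · exact r.trans (r.trans h1 (r.symm h)) h2

lemma card_quotient_le_joinPair {α : Type*} [Finite α] (r : Setoid α) (a b : α) :
    Nat.card (Quotient r) ≤ Nat.card (Quotient (joinPair r a b)) + 1 := by
  classical
  rw [← Finite.card_option]
  refine Nat.card_le_card_of_injective (Quotient.lift (fun x => if r x a then none else
    some (Quotient.mk (joinPair r a b) x)) ?_) ?_
  · intro x y hxy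
    have h : r x a ↔ r y a := ⟨fun h => r.trans (r.symm hxy) h, fun h => r.trans hxy h⟩
    simp only [h]
    split_ifs
    · rfl
    · exact congrArg some (Quotient.sound (s := joinPair r a b) (Or.inl hxy))
  · intro p q
    induction p using Quotient.inductionOn with | h x
    induction q using Quotient.inductionOn with | h y
    simp only [Quotient.lift_mk]
    intro h
    apply Quotient.sound
    split_ifs at h with h1 h2 h2
    · exact r.trans h1 (r.symm h2)
    · rcases Quotient.exact (s := joinPair r a b) (Option.some_injective _ h) with
        h | h | h
      · exact h
      · exact absurd h.1 h1
      · exact absurd (r.symm h.2) h2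

lemma card_quotient_joinPair_le {α : Type*} [Finite α] (r : Setoid α) (a b : α) :
    Nat.card (Quotient (joinPair r a b)) ≤ Nat.card (Quotient r) := by
  refine Nat.card_le_card_of_surjective
    (Quotient.map' (s₁ := r) (s₂ := joinPair r a b) id fun x y h => Or.inl h) ?_
  intro q
  induction q using Quotient.inductionOn with | h x
  exact ⟨Quotient.mk r x, rfl⟩

lemma card_quotient_joinPair_lt {α : Type*} [Finite α] {r : Setoid α} {a b : α} (h : ¬ r a b) :
    Nat.card (Quotient (joinPair r a b)) < Nat.card (Quotient r) := by
  classical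
  have := Fintype.ofFinite (Quotient r)
  have := Fintype.ofFinite (Quotient (joinPair r a b))
  rw [Nat.card_eq_fintype_card, Nat.card_eq_fintype_card]
  refine Fintype.card_lt_of_surjective_not_injective
    (Quotient.map' (s₁ := r) (s₂ := joinPair r a b) id fun x y h => Or.inl h) ?_ ?_
  · intro q
    induction q using Quotient.inductionOn with | h x
    exact ⟨Quotient.mk r x, rfl⟩
  · intro hi
    refine h (Quotient.exact (hi (?_ : _ = _) : Quotient.mk r a = Quotient.mk r b))
    exact Quotient.sound (s := joinPair r a b) (Or.inr (Or.inl ⟨r.refl a, r.refl b⟩))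

/-! ### Splitting and merging cycles by a transposition -/

lemma setoid_le_joinPair_swap_mul {n : ℕ} (σ : Perm (Fin n)) (a b : Fin n) :
    Perm.SameCycle.setoid σ ≤ joinPair (Perm.SameCycle.setoid (swap a b * σ)) a b := by
  intro x y hxy
  obtain ⟨m, rfl⟩ := Perm.SameCycle.exists_nat_pow_eq hxy
  induction m with
  | zero => exact (joinPair _ a b).refl _
  | succ m ih =>
    refine (joinPair _ a b).trans (ih ⟨m, by simp⟩) ?_
    rw [pow_succ', Perm.mul_apply]
    set z := (σ ^ m) x
    have hz : (swap a b * σ).SameCycle z (swap a b (σ z)) := by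
      rw [← Perm.mul_apply, Perm.sameCycle_apply_right]
    by_cases ha : σ z = a
    · rw [ha, swap_apply_left] at hz
      rw [ha]
      exact Or.inr (Or.inr ⟨hz, Perm.SameCycle.rfl⟩)
    · by_cases hb : σ z = b
      · rw [hb, swap_apply_right] at hz
        rw [hb]
        exact Or.inr (Or.inl ⟨hz, Perm.SameCycle.rfl⟩)
      · rw [swap_apply_of_ne_of_ne ha hb] at hz
        exact Or.inl hz

lemma joinPair_le_joinPair {α : Type*} {r s : Setoid α} {a b : α} (h : r ≤ joinPair s a b) :
    joinPair r a b ≤ joinPair s a b := by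
  have hab : joinPair s a b a b := Or.inr (Or.inl ⟨s.refl a, s.refl b⟩)
  rintro x y (h' | ⟨h1, h2⟩ | ⟨h1, h2⟩)
  · exact h h'
  · exact (joinPair s a b).trans ((joinPair s a b).trans (h h1) hab) (h h2)
  · exact (joinPair s a b).trans ((joinPair s a b).trans (h h1) ((joinPair s a b).symm hab)) (h h2)

/-- Once `a` and `b` are identified, the transposition `(a b)` becomes invisible, so both
permutations have the same joined classes. Since joining two classes loses at most one, their
numbers of cycles differ by at most one. -/
lemma joinPair_swap_mul {n : ℕ} (σ : Perm (Fin n)) (a b : Fin n) :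
    joinPair (Perm.SameCycle.setoid (swap a b * σ)) a b =
      joinPair (Perm.SameCycle.setoid σ) a b := by
  apply le_antisymm
  · apply joinPair_le_joinPair
    have := setoid_le_joinPair_swap_mul (swap a b * σ) a b
    rwa [← mul_assoc, swap_mul_self, one_mul] at this
  · exact joinPair_le_joinPair (setoid_le_joinPair_swap_mul σ a b)

lemma numCycles_swap_mul_le {n : ℕ} (σ : Perm (Fin n)) (a b : Fin n) :
    numCycles (swap a b * σ) ≤ numCycles σ + 1 := by
  rw [numCycles_eq_card_quotient, numCycles_eq_card_quotient]
  refine (card_quotient_le_joinPair _ a b).trans ?_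
  rw [joinPair_swap_mul]
  exact Nat.succ_le_succ (card_quotient_joinPair_le _ a b)

lemma numCycles_swap_mul_of_sameCycle {n : ℕ} {σ : Perm (Fin n)} {a b : Fin n} (hab : a ≠ b)
    (h : σ.SameCycle a b) : numCycles (swap a b * σ) = numCycles σ + 1 := by
  have h1 := numCycles_swap_mul_le σ a b
  have h2 : numCycles σ ≤ numCycles (swap a b * σ) := by
    rw [numCycles_eq_card_quotient, numCycles_eq_card_quotient]
    have := card_quotient_joinPair_le (Perm.SameCycle.setoid (swap a b * σ)) a b
    rwa [joinPair_swap_mul, joinPair_eq_self (r := Perm.SameCycle.setoid σ) h] at this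
  -- The sign is the parity of the number of cycles up to a constant, and a transposition changes
  -- it; this excludes equality.
  have h3 : numCycles (swap a b * σ) ≠ numCycles σ := by
    intro h3
    have h4 : Perm.sign (swap a b * σ) = Perm.sign σ := by
      rw [sign_eq_pow_numCycles, sign_eq_pow_numCycles, h3]
    rw [Perm.sign_mul, Perm.sign_swap hab, mul_eq_right] at h4
    exact absurd h4 (by decide)
  omega

lemma numCycles_swap_mul_of_not_sameCycle {n : ℕ} {σ : Perm (Fin n)} {a b : Fin n}
    (h : ¬ σ.SameCycle a b) : numCycles (swap a b * σ) ≤ numCycles σ := by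
  rw [numCycles_eq_card_quotient, numCycles_eq_card_quotient]
  refine (card_quotient_le_joinPair _ a b).trans ?_
  rw [joinPair_swap_mul]
  exact card_quotient_joinPair_lt (r := Perm.SameCycle.setoid σ) h

/-! ### Minimal factorizations and splitting sequences -/

lemma exists_swap_factorization {n : ℕ} (σ : Perm (Fin n)) :
    ∃ L : List (Perm (Fin n)), (∀ τ ∈ L, τ.IsSwap) ∧ L.prod = σ ∧
      L.length + numCycles σ = n := by
  induction hm : n - numCycles σ generalizing σ with
  | zero =>
    by_cases h1 : σ = 1
    · exact ⟨[], by simp, by simp [h1], by simp [h1, numCycles_one]⟩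
    -- Impossible case: splitting off a point from a nontrivial `σ` with `n` cycles would give `n +
    -- 1` cycles.
    · obtain ⟨x, hx⟩ : ∃ x, ¬ σ x = x := not_forall.1 fun h => h1 (Perm.ext h)
      have := numCycles_swap_mul_of_sameCycle (Ne.symm hx)
        (Perm.sameCycle_apply_right.2 (Perm.SameCycle.refl σ x))
      have := numCycles_le (swap x (σ x) * σ)
      omega
  | succ m ih =>
    by_cases h1 : σ = 1
    · simp [h1, numCycles_one] at hm
    · obtain ⟨x, hx⟩ : ∃ x, ¬ σ x = x := not_forall.1 fun h => h1 (Perm.ext h)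
      have h2 := numCycles_swap_mul_of_sameCycle (Ne.symm hx)
        (Perm.sameCycle_apply_right.2 (Perm.SameCycle.refl σ x))
      obtain ⟨L, hL, hp, hl⟩ := ih (swap x (σ x) * σ) (by omega)
      refine ⟨swap x (σ x) :: L, ?_, ?_, ?_⟩
      · rw [List.forall_mem_cons]
        exact ⟨⟨x, σ x, Ne.symm hx, rfl⟩, hL⟩
      · rw [List.prod_cons, hp, ← mul_assoc, swap_mul_self, one_mul]
      · rw [List.length_cons]; omega

/-- The largest element displaced by a transposition. -/
def high {n : ℕ} [NeZero n] (τ : Perm (Fin n)) : Fin n := τ (low τ)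

lemma high_swap {n : ℕ} [NeZero n] {a b : Fin n} (h : a < b) : high (swap a b) = b := by
  rw [high, low_swap h, swap_apply_left]

lemma low_lt_high {n : ℕ} [NeZero n] {τ : Perm (Fin n)} (h : τ.IsSwap) : low τ < high τ := by
  obtain ⟨a, b, hab, rfl⟩ := exists_lt_of_isSwap h
  rwa [low_swap hab, high_swap hab]

lemma eq_swap_low_high {n : ℕ} [NeZero n] {τ : Perm (Fin n)} (h : τ.IsSwap) :
    τ = swap (low τ) (high τ) := by
  obtain ⟨a, b, hab, rfl⟩ := exists_lt_of_isSwap h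
  rw [low_swap hab, high_swap hab]

/-- Multiplying `σ` on the left successively by the transpositions in the list splits a cycle at
each step. -/
def Splits {n : ℕ} [NeZero n] : List (Perm (Fin n)) → Perm (Fin n) → Prop
  | [], _ => True
  | τ :: L, σ => σ.SameCycle (low τ) (high τ) ∧ Splits L (τ * σ)

/-- Each factor adds at most one cycle, so the maximal increase occurs only if every factor splits a
cycle. Transpositions being involutions, the inverse of the product applies them in the order of the
list. -/
lemma numCycles_prod_inv_mul {n : ℕ} [NeZero n] {L : List (Perm (Fin n))}
    (hL : ∀ τ ∈ L, τ.IsSwap) (σ : Perm (Fin n)) :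
    numCycles (L.prod⁻¹ * σ) ≤ numCycles σ + L.length ∧
      (numCycles (L.prod⁻¹ * σ) = numCycles σ + L.length ↔ Splits L σ) := by
  induction L generalizing σ with
  | nil => simp [Splits]
  | cons τ L ih =>
    rw [List.forall_mem_cons] at hL
    obtain ⟨h1, h2⟩ := ih hL.2 (τ * σ)
    have he : (τ :: L).prod⁻¹ * σ = L.prod⁻¹ * (τ * σ) := by
      rw [List.prod_cons, mul_inv_rev, inv_eq_of_isSwap hL.1, mul_assoc]
    rw [he, Splits, ← h2, List.length_cons]
    have h3 := numCycles_swap_mul_le σ (low τ) (high τ)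
    rw [← eq_swap_low_high hL.1] at h3
    by_cases hs : σ.SameCycle (low τ) (high τ)
    · have h4 := numCycles_swap_mul_of_sameCycle (low_lt_high hL.1).ne hs
      rw [← eq_swap_low_high hL.1] at h4
      refine ⟨by omega, ⟨fun h => ⟨hs, by omega⟩, fun h => by omega⟩⟩
    · have h4 := numCycles_swap_mul_of_not_sameCycle hs
      rw [← eq_swap_low_high hL.1] at h4
      exact ⟨by omega, ⟨fun h => by omega, fun h => absurd h.1 hs⟩⟩

lemma sameCycle_of_apply_eq_add_one {n : ℕ} {σ : Perm (Fin n)} {i j : Fin n} (hij : i ≤ j)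
    (h : ∀ x, i ≤ x → x < j → (σ x : ℕ) = x + 1) : σ.SameCycle i j := by
  obtain ⟨d, hd⟩ := Nat.exists_eq_add_of_le (Fin.le_def.1 hij)
  induction d generalizing j with
  | zero =>
    rw [Fin.ext (by simpa using hd) (a := j) (b := i)]
  | succ d ih =>
    let x : Fin n := ⟨i + d, by omega⟩
    have hx : i ≤ x := Fin.le_def.2 (by simp [x])
    have hxj : x < j := Fin.lt_def.2 (by simp only [x]; omega)
    have := ih hx (fun y h1 h2 => h y h1 (h2.trans hxj)) rfl
    have hj : σ x = j := Fin.ext (by rw [h x hx hxj, hd]; rfl)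
    rw [← hj]
    exact Perm.sameCycle_apply_right.2 this

lemma finRotate_val {n : ℕ} (x : Fin n) (h : (x : ℕ) + 1 < n) :
    (finRotate n x : ℕ) = x + 1 := by
  obtain ⟨m, rfl⟩ : ∃ m, n = m + 1 := ⟨n - 1, by omega⟩
  rw [finRotate_apply, Fin.val_add, Fin.val_one', Nat.add_mod_mod, Nat.mod_eq_of_lt h]

lemma numCycles_finRotate (n : ℕ) [NeZero n] : numCycles (finRotate n) = 1 := by
  rw [numCycles_eq_card_quotient, Nat.card_eq_one_iff_unique]
  have h0 : ∀ x, (finRotate n).SameCycle 0 x := fun x =>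
    sameCycle_of_apply_eq_add_one (Fin.zero_le x) fun y _ hy =>
      finRotate_val y (by have := x.2; have := Fin.lt_def.1 hy; omega)
  refine ⟨⟨fun p q => ?_⟩, ⟨Quotient.mk _ 0⟩⟩
  induction p using Quotient.inductionOn with | h x
  induction q using Quotient.inductionOn with | h y
  exact Quotient.sound ((h0 x).symm.trans (h0 y))

lemma mem_prefixes_iff {n k : ℕ} [NeZero n] {γ : Fin k → Perm (Fin n)} :
    γ ∈ prefixes n k ↔ (∀ l, (γ l).IsSwap) ∧ Splits (List.ofFn γ) (finRotate n) := by
  refine and_congr_right fun hs => ?_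
  have hL : ∀ τ ∈ List.ofFn γ, τ.IsSwap := by
    intro τ hτ
    obtain ⟨i, rfl⟩ := List.mem_ofFn.1 hτ
    exact hs i
  obtain ⟨h1, h2⟩ := numCycles_prod_inv_mul hL (finRotate n)
  rw [← h2, numCycles_finRotate, List.length_ofFn]
  rw [numCycles_finRotate, List.length_ofFn] at h1
  change len (pathProd γ) = k ∧ len (finRotate n) = len (pathProd γ) +
    len ((pathProd γ)⁻¹ * finRotate n) ↔ numCycles ((pathProd γ)⁻¹ * finRotate n) = 1 + k
  change numCycles ((pathProd γ)⁻¹ * finRotate n) ≤ 1 + k at h1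
  have h3 := numCycles_le ((pathProd γ)⁻¹ * finRotate n)
  have h4 := numCycles_le (pathProd γ)
  have hn : 0 < n := Nat.pos_of_ne_zero (NeZero.ne n)
  -- Going from the product itself to the identity creates `len (pathProd γ)` cycles in `k` steps.
  have h5 : len (pathProd γ) ≤ k := by
    have h := (numCycles_prod_inv_mul hL (pathProd γ)).1
    rw [pathProd, inv_mul_cancel, numCycles_one, List.length_ofFn] at h
    rw [len, pathProd]
    omega
  -- The triangle inequality for `len`, from a minimal factorization. With `h5`, having `1 + k`
  -- cycles forces `len (pathProd γ) = k`.
  have h6 : numCycles ((pathProd γ)⁻¹ * finRotate n) ≤ 1 + len (pathProd γ) := by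
    obtain ⟨L, hL', hp, hl⟩ := exists_swap_factorization (pathProd γ)
    have h := (numCycles_prod_inv_mul hL' (finRotate n)).1
    rw [hp, numCycles_finRotate] at h
    simp only [len]
    omega
  simp only [len, numCycles_finRotate] at *
  omega

/-! ### Paths with non-decreasing sequence of smallest elements -/

/-- For transpositions `τ = (i j)` and `υ = (a b)` with `i ≤ a`: the intervals `[i, j)` and
`[a, b)` are disjoint, or the second one is contained in the first one and `b < j`. -/
def Nested {n : ℕ} [NeZero n] (τ υ : Perm (Fin n)) : Prop :=
  high τ ≤ low υ ∨ high υ < high τ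

lemma iff_of_sameCycle {α : Type*} [Finite α] {σ : Perm α} {p : α → Prop}
    (h : ∀ x, p (σ x) ↔ p x) {x y : α} (hxy : σ.SameCycle x y) : p x ↔ p y := by
  obtain ⟨m, rfl⟩ := hxy.exists_nat_pow_eq
  induction m with
  | zero => rfl
  | succ m ih => rw [pow_succ', Perm.mul_apply, h]; exact ih ⟨m, by simp⟩

lemma apply_iff_of_mapsTo {α : Type*} [Finite α] {σ : Perm α} {p : α → Prop}
    (h : ∀ x, p x → p (σ x)) (x : α) : p (σ x) ↔ p x := by
  refine ⟨fun hx => ?_, h x⟩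
  obtain ⟨m, hm⟩ := (Perm.sameCycle_apply_left.2 (Perm.SameCycle.refl σ x)).exists_nat_pow_eq
  rw [← hm]
  clear hm
  induction m with
  | zero => exact hx
  | succ m ih => rw [pow_succ', Perm.mul_apply]; exact h _ ih

/-- `P` collects the transpositions already multiplied onto the long cycle and `σ` is the outcome.
Two facts propagate: to the right of all smaller ends `σ` still moves one step, except just before a
larger end, and every interval `[low p, high p)` is stable. If `q` is nested with all of `P`,
one-step moves lead from `low q` to `high q`; otherwise a stable interval contains `low q` but not
`high q`. -/
lemma splits_iff_of_invariant {n : ℕ} [NeZero n] {L : List (Perm (Fin n))}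
    (hL : ∀ q ∈ L, q.IsSwap) (hs : L.Pairwise fun p q => low p ≤ low q)
    (P : List (Perm (Fin n))) (hPL : ∀ p ∈ P, ∀ q ∈ L, low p ≤ low q) (σ : Perm (Fin n))
    (hsucc : ∀ x, (∀ p ∈ P, low p ≤ x) → (x : ℕ) + 1 < n → (∀ p ∈ P, (high p : ℕ) ≠ x + 1) →
      (σ x : ℕ) = x + 1)
    (hinv : ∀ p ∈ P, ∀ x, (low p ≤ σ x ∧ σ x < high p) ↔ (low p ≤ x ∧ x < high p)) :
    Splits L σ ↔ (∀ p ∈ P, ∀ q ∈ L, Nested p q) ∧ L.Pairwise Nested := by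
  induction L generalizing P σ with
  | nil => simp [Splits]
  | cons q L ih =>
    rw [List.forall_mem_cons] at hL
    rw [List.pairwise_cons] at hs
    have hPq : ∀ p ∈ P, low p ≤ low q := fun p hp => hPL p hp q (by simp)
    have hq := low_lt_high hL.1
    have hstep : (∀ p ∈ P, Nested p q) → ∀ x, low q ≤ x → x < high q → (σ x : ℕ) = x + 1 := by
      intro hN x h1 h2
      refine hsucc x (fun p hp => (hPq p hp).trans h1)
        (by have := (high q).2; rw [Fin.lt_def] at h2; omega) fun p hp he => ?_
      rw [Fin.le_def] at h1
      rw [Fin.lt_def] at h2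
      rcases hN p hp with h | h
      · rw [Fin.le_def] at h; omega
      · rw [Fin.lt_def] at h; omega
    have hcyc : σ.SameCycle (low q) (high q) ↔ ∀ p ∈ P, Nested p q := by
      constructor
      · intro hc p hp
        have := iff_of_sameCycle (p := fun x => low p ≤ x ∧ x < high p) (hinv p hp) hc
        rcases le_or_gt (high p) (low q) with h | h
        · exact Or.inl h
        · exact Or.inr (this.1 ⟨hPq p hp, h⟩).2
      · exact fun hN => sameCycle_of_apply_eq_add_one hq.le (hstep hN)
    have hnext : (∀ p ∈ P, Nested p q) →
        (Splits L (q * σ) ↔ (∀ p ∈ q :: P, ∀ q' ∈ L, Nested p q') ∧ L.Pairwise Nested) := by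
      intro hN
      have hqx : ∀ x, (q * σ) x = swap (low q) (high q) (σ x) := fun x => by
        rw [← eq_swap_low_high hL.1, Perm.mul_apply]
      apply ih hL.2 hs.2
      · intro p hp q' hq'
        rcases List.mem_cons.1 hp with rfl | hp
        · exact hs.1 q' hq'
        · exact hPL p hp q' (by simp [hq'])
      · intro x h1 h2 h3
        rw [List.forall_mem_cons] at h1 h3
        have h4 := hsucc x h1.2 h2 h3.2
        rw [hqx, swap_apply_of_ne_of_ne, h4]
        · intro h
          have := Fin.le_def.1 h1.1
          rw [← h, h4] at this
          omega
        · intro h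
          apply h3.1
          rw [← h, h4]
      · intro p hp
        rcases List.mem_cons.1 hp with rfl | hp
        -- Only the last point of the new interval leaves it under `σ`, and the transposition sends
        -- its image back to the left end.
        · refine apply_iff_of_mapsTo (p := fun x => low p ≤ x ∧ x < high p) fun x hx => ?_
          have h4 := hstep hN x hx.1 hx.2
          rw [hqx]
          by_cases h : σ x = high p
          · rw [h, swap_apply_right]
            exact ⟨le_rfl, hq⟩
          · have h5 : σ x < high p := by
              refine lt_of_le_of_ne ?_ h
              have := hx.2
              rw [Fin.lt_def] at this
              rw [Fin.le_def, h4]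
              omega
            have h6 : low p < σ x := by
              have := hx.1
              rw [Fin.le_def] at this
              rw [Fin.lt_def, h4]
              omega
            rw [swap_apply_of_ne_of_ne h6.ne' h]
            exact ⟨h6.le, h5⟩
        · intro x
          rw [← hinv p hp x, hqx]
          -- By nesting, both ends of `q` lie inside the older interval or both outside, so
          -- exchanging them keeps it stable.
          have hlh : low q < high p ↔ high q < high p := by
            rcases hN p hp with h | h
            · exact iff_of_false (not_lt.2 h) (not_lt.2 (h.trans hq.le))
            · exact iff_of_true (hq.trans h) h
          have hl1 := hPq p hp
          have hl2 := hl1.trans hq.le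
          by_cases h1 : σ x = low q
          · simp [h1, hl1, hl2, hlh]
          · by_cases h2 : σ x = high q
            · simp [h2, hl1, hl2, hlh]
            · rw [swap_apply_of_ne_of_ne h1 h2]
    rw [Splits, hcyc, List.pairwise_cons]
    constructor
    · rintro ⟨h1, h2⟩
      obtain ⟨h3, h4⟩ := (hnext h1).1 h2
      rw [List.forall_mem_cons] at h3
      exact ⟨fun p hp q' hq' => by
        rcases List.mem_cons.1 hq' with rfl | hq'
        exacts [h1 p hp, h3.2 p hp q' hq'], h3.1, h4⟩
    · rintro ⟨h1, h2, h3⟩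
      have hN : ∀ p ∈ P, Nested p q := fun p hp => h1 p hp q (by simp)
      refine ⟨hN, (hnext hN).2 ⟨?_, h3⟩⟩
      rw [List.forall_mem_cons]
      exact ⟨h2, fun p hp q' hq' => h1 p hp q' (by simp [hq'])⟩

lemma mem_prefixes_iff_nested {n k : ℕ} [NeZero n] {γ : Fin k → Perm (Fin n)}
    (hm : Monotone fun l => low (γ l)) :
    γ ∈ prefixes n k ↔ (∀ l, (γ l).IsSwap) ∧ ∀ l m, l < m → Nested (γ l) (γ m) := by
  rw [mem_prefixes_iff]
  refine and_congr_right fun hs => ?_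
  rw [splits_iff_of_invariant (P := [])]
  · simp [List.pairwise_ofFn]
  · intro τ hτ
    obtain ⟨i, rfl⟩ := List.mem_ofFn.1 hτ
    exact hs i
  · rw [List.pairwise_ofFn]
    exact fun i j hij => hm hij.le
  · simp
  · exact fun x _ hx _ => finRotate_val x hx
  · simp

/-! ### Parking -/

lemma finRotate_pow_val {n : ℕ} (s : ℕ) (e : Fin n) :
    ((finRotate n ^ s) e).val = (e.val + s) % n := by
  obtain ⟨m, rfl⟩ : ∃ m, n = m + 1 := ⟨n - 1, by have := e.2; omega⟩
  induction s with
  | zero => simpa using (Nat.mod_eq_of_lt e.2).symm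
  | succ s ih =>
    rw [pow_succ', Perm.mul_apply, finRotate_apply, Fin.val_add, ih, Fin.val_one',
      Nat.add_mod_mod, Nat.mod_add_mod, add_assoc]

lemma firstOpen_eq_of_lt {n : ℕ} {O : Finset (Fin n)} {e p : Fin n} (hp : p ∈ O) (he : e < p)
    (hmin : ∀ b ∈ O, e < b → p ≤ b) : firstOpen O e = p := by
  have hpn := p.2
  rw [Fin.lt_def] at he
  have hval : (finRotate n ^ ((p : ℕ) - e)) e = p := by
    rw [Fin.ext_iff, finRotate_pow_val, Nat.add_sub_cancel' he.le, Nat.mod_eq_of_lt hpn]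
  have hleast : IsLeast {s : ℕ | 1 ≤ s ∧ s ≤ n ∧ (finRotate n ^ s) e ∈ O} ((p : ℕ) - e) := by
    refine ⟨⟨by omega, by omega, by rwa [hval]⟩, ?_⟩
    rintro s ⟨h1, -, h3⟩
    by_contra hlt
    have hv := finRotate_pow_val s e
    rw [Nat.mod_eq_of_lt (by omega)] at hv
    have := Fin.le_def.1 (hmin _ h3 (Fin.lt_def.2 (by omega)))
    omega
  rw [firstOpen, hleast.csInf_eq, hval]

lemma firstOpen_eq_zero {n : ℕ} [NeZero n] {O : Finset (Fin n)} {e : Fin n} (h0 : 0 ∈ O)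
    (he : ∀ b ∈ O, b ≤ e) : firstOpen O e = 0 := by
  have hen := e.2
  have hval : (finRotate n ^ (n - (e : ℕ))) e = 0 := by
    rw [Fin.ext_iff, finRotate_pow_val, Nat.add_sub_cancel' hen.le, Nat.mod_self, Fin.val_zero]
  have hleast : IsLeast {s : ℕ | 1 ≤ s ∧ s ≤ n ∧ (finRotate n ^ s) e ∈ O} (n - (e : ℕ)) := by
    refine ⟨⟨by omega, by omega, by rwa [hval]⟩, ?_⟩
    rintro s ⟨h1, -, h3⟩
    by_contra hlt
    have hv := finRotate_pow_val s e
    rw [Nat.mod_eq_of_lt (by omega)] at hv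
    have := Fin.le_def.1 (he _ h3)
    omega
  rw [firstOpen, hleast.csInf_eq, hval]

lemma parking_last {n k : ℕ} (E : Fin (k + 1) → Fin n) (O : Finset (Fin n)) :
    parking E O (Fin.last k) = firstOpen O (E (Fin.last k)) := by
  simp [parking]

lemma parking_castSucc {n k : ℕ} (E : Fin (k + 1) → Fin n) (O : Finset (Fin n)) (l : Fin k) :
    parking E O l.castSucc =
      parking (fun l => E l.castSucc) (O.erase (firstOpen O (E (Fin.last k)))) l := by
  simp [parking]

lemma parking_mem_injective {n k : ℕ} (E : Fin k → Fin n) (O : Finset (Fin n))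
    (hO : O.card = k + 1) :
    (∀ l, parking E O l ∈ O) ∧ Function.Injective (parking E O) := by
  induction k generalizing O with
  | zero => exact ⟨fun l => l.elim0, fun l => l.elim0⟩
  | succ k ih =>
    have hp := firstOpen_mem (O := O) (Finset.card_pos.1 (by omega)) (E (Fin.last k))
    obtain ⟨h1, h2⟩ := ih (fun l => E l.castSucc) (O.erase (firstOpen O (E (Fin.last k))))
      (by rw [Finset.card_erase_of_mem hp, hO]; rfl)
    constructor
    · intro l
      induction l using Fin.lastCases with
      | last => rwa [parking_last]
      | cast l => rw [parking_castSucc]; exact Finset.mem_of_mem_erase (h1 l)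
    · rw [parking, Fin.snoc_injective_iff]
      refine ⟨h2, ?_⟩
      rintro ⟨l, hl⟩
      exact Finset.ne_of_mem_erase (h1 l) hl

lemma residue_eq_iff {n k : ℕ} [NeZero n] {E : Fin k → Fin n} {O : Finset (Fin n)}
    (hO : O.card = k + 1) {x : Fin n} :
    residue E O = x ↔ x ∈ O ∧ ∀ l, parking E O l ≠ x := by
  have h := vacant_eq E O hO
  have : x ∈ vacant E O ↔ x = residue E O := by rw [h, Finset.mem_singleton]
  rw [eq_comm, ← this, vacant]
  simp

/-- Every cyclist parks, to the right of the starting point, in the first space which is not taken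
by a cyclist with larger index; nobody passes the end of the street. -/
def ParksLinearly {n k : ℕ} (E : Fin k → Fin n) (O : Finset (Fin n)) (p : Fin k → Fin n) : Prop :=
  ∀ l, p l ∈ O ∧ E l < p l ∧ ∀ b ∈ O, E l < b → b < p l → ∃ m, l < m ∧ b = p m

/-- A cyclist passing the end of the street would meet the space `0` first and take it, as it is
still free. -/
lemma parksLinearly_parking {n k : ℕ} [NeZero n] {E : Fin k → Fin n} {O : Finset (Fin n)}
    (h0 : 0 ∈ O) (hv : ∀ l, parking E O l ≠ 0) : ParksLinearly E O (parking E O) := by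
  induction k generalizing O with
  | zero => exact fun l => l.elim0
  | succ k ih =>
    set q := firstOpen O (E (Fin.last k)) with hq
    have hq0 : q ≠ 0 := by rw [hq, ← parking_last]; exact hv _
    have hex : (O.filter (E (Fin.last k) < ·)).Nonempty := by
      rw [Finset.nonempty_iff_ne_empty]
      intro he
      rw [Finset.filter_eq_empty_iff] at he
      exact hq0 (firstOpen_eq_zero h0 fun b hb => not_lt.1 (he hb))
    have hmem := Finset.mem_filter.1 (Finset.min'_mem _ hex)
    have hmin : ∀ b ∈ O, E (Fin.last k) < b → Finset.min' _ hex ≤ b := fun b hb hlt =>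
      Finset.min'_le _ _ (Finset.mem_filter.2 ⟨hb, hlt⟩)
    have hqm : q = Finset.min' _ hex := firstOpen_eq_of_lt hmem.1 hmem.2 hmin
    rw [← hqm] at hmem hmin
    intro l
    induction l using Fin.lastCases with
    | last =>
      rw [parking_last, ← hq]
      exact ⟨hmem.1, hmem.2, fun b hb h1 h2 => absurd h2 (not_lt.2 (hmin b hb h1))⟩
    | cast l =>
      obtain ⟨h1, h2, h3⟩ := ih (E := fun l => E l.castSucc) (O := O.erase q)
        (Finset.mem_erase.2 ⟨hq0.symm, h0⟩)
        (fun l => by rw [hq, ← parking_castSucc]; exact hv _) l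
      rw [parking_castSucc, ← hq]
      refine ⟨Finset.mem_of_mem_erase h1, h2, fun b hb hb1 hb2 => ?_⟩
      by_cases hbq : b = q
      · exact ⟨Fin.last k, Fin.castSucc_lt_last l, by rw [parking_last, hbq]⟩
      · obtain ⟨m, hm, rfl⟩ := h3 b (Finset.mem_erase.2 ⟨hbq, hb⟩) hb1 hb2
        exact ⟨m.castSucc, by simpa using hm, by rw [parking_castSucc]⟩

/-- The last cyclist has no larger index to yield to, so the space is forced; erase it and repeat.
-/
lemma ParksLinearly.parking_eq {n k : ℕ} {E : Fin k → Fin n} {O : Finset (Fin n)}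
    {p : Fin k → Fin n} (hp : ParksLinearly E O p) (hi : Function.Injective p) :
    parking E O = p := by
  induction k generalizing O with
  | zero => exact funext fun l => l.elim0
  | succ k ih =>
    have hlast : firstOpen O (E (Fin.last k)) = p (Fin.last k) := by
      obtain ⟨h1, h2, h3⟩ := hp (Fin.last k)
      refine firstOpen_eq_of_lt h1 h2 fun b hb hlt => not_lt.1 fun h => ?_
      obtain ⟨m, hm, -⟩ := h3 b hb hlt h
      exact absurd hm (not_lt.2 (Fin.le_last m))
    have hrest := ih (E := fun l => E l.castSucc) (O := O.erase (p (Fin.last k)))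
      (p := fun l => p l.castSucc) (fun l => ?_)
      (hi.comp (Fin.castSucc_injective k))
    · funext l
      induction l using Fin.lastCases with
      | last => rw [parking_last, hlast]
      | cast l => rw [parking_castSucc, hlast, hrest]
    · obtain ⟨h1, h2, h3⟩ := hp l.castSucc
      refine ⟨Finset.mem_erase.2 ⟨fun h => (Fin.castSucc_lt_last l).ne (hi h), h1⟩, h2, ?_⟩
      intro b hb hb1 hb2
      obtain ⟨hb, hb'⟩ := Finset.mem_erase.1 hb
      obtain ⟨m, hm, rfl⟩ := h3 b hb' hb1 hb2
      induction m using Fin.lastCases with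
      | last => exact absurd rfl hb
      | cast m => exact ⟨m, by simpa using hm, rfl⟩

/-! ### The counting criterion for residue `0` -/

lemma parking_ne_zero_of_card_le {n k : ℕ} [NeZero n] {E : Fin k → Fin n} {O : Finset (Fin n)}
    (h0 : 0 ∈ O)
    (h : ∀ t, (Finset.univ.filter fun l => t ≤ E l).card ≤ (O.filter fun b => t < b).card)
    (l : Fin k) : parking E O l ≠ 0 := by
  induction k generalizing O with
  | zero => exact l.elim0
  | succ k ih =>
    set e := E (Fin.last k)
    have hcount : ∀ t, (Finset.univ.filter fun l => t ≤ E l).card =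
        (Finset.univ.filter fun l : Fin k => t ≤ E l.castSucc).card + if t ≤ e then 1 else 0 := by
      intro t
      rw [Finset.card_filter, Finset.card_filter, Fin.sum_univ_castSucc]
    have hex : (O.filter (e < ·)).Nonempty := by
      rw [← Finset.card_pos]
      have h1 := h e
      rw [hcount, if_pos le_rfl] at h1
      omega
    have hmem := Finset.mem_filter.1 (Finset.min'_mem _ hex)
    have hmin : ∀ b ∈ O, e < b → Finset.min' _ hex ≤ b := fun b hb hlt =>
      Finset.min'_le _ _ (Finset.mem_filter.2 ⟨hb, hlt⟩)
    set q := Finset.min' _ hex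
    have hq : firstOpen O e = q := firstOpen_eq_of_lt hmem.1 hmem.2 hmin
    have hq0 : q ≠ 0 := ((Fin.zero_le e).trans_lt hmem.2).ne'
    induction l using Fin.lastCases with
    | last => rwa [parking_last, hq]
    | cast l =>
      rw [parking_castSucc, hq]
      refine ih (Finset.mem_erase.2 ⟨hq0.symm, h0⟩) (fun t => ?_) l
      have h1 := h t
      rw [hcount] at h1
      have hfilt : ((O.erase q).filter fun b => t < b) = (O.filter fun b => t < b).erase q :=
        Finset.filter_erase _ _ _
      rw [hfilt]
      by_cases htq : t < q
      · have hcard := Finset.card_erase_of_mem (Finset.mem_filter (p := fun b => t < b).2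
          ⟨hmem.1, htq⟩)
        by_cases hte : t ≤ e
        · rw [if_pos hte] at h1
          omega
        -- For `e < t < q` the spaces lose `q` while no cyclist is lost. There is no space strictly
        -- between `e` and `q`, so the hypothesis at `e`, which also counts the last cyclist,
        -- provides the missing unit.
        · have h2 := h e
          rw [hcount, if_pos le_rfl] at h2
          have h3 : (O.filter fun b => e < b) = O.filter fun b => t < b := by
            refine Finset.filter_congr fun b hb => ⟨fun hb' => ?_, (not_le.1 hte).trans⟩
            exact htq.trans_le (hmin b hb hb')
          have h4 : (Finset.univ.filter fun l : Fin k => t ≤ E l.castSucc).card ≤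
              (Finset.univ.filter fun l : Fin k => e ≤ E l.castSucc).card :=
            Finset.card_le_card (Finset.monotone_filter_right _
              fun l _ hl => (not_le.1 hte).le.trans hl)
          rw [h3] at h2
          omega
      · rw [Finset.erase_eq_of_notMem (by simp [htq])]
        omega

/-- When nobody rides past the end, parking injects the cyclists starting at `t` or later into the
spaces beyond `t`. The point of the criterion is that it ignores the order of the cyclists. -/
lemma residue_eq_zero_iff {n k : ℕ} [NeZero n] {E : Fin k → Fin n} {O : Finset (Fin n)}
    (hO : O.card = k + 1) :
    residue E O = 0 ↔ 0 ∈ O ∧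
      ∀ t, (Finset.univ.filter fun l => t ≤ E l).card ≤ (O.filter fun b => t < b).card := by
  rw [residue_eq_iff hO]
  refine and_congr_right fun h0 => ⟨fun hv t => ?_, parking_ne_zero_of_card_le h0⟩
  have hp := parksLinearly_parking h0 hv
  refine Finset.card_le_card_of_injOn (parking E O) (fun l hl => ?_)
    (parking_mem_injective E O hO).2.injOn
  have hl := (Finset.mem_filter.1 hl).2
  exact Finset.mem_coe.2 (Finset.mem_filter.2 ⟨(hp l).1, hl.trans_lt (hp l).2.1⟩)

lemma residue_comp_perm_eq_zero_iff {n k : ℕ} [NeZero n] {E : Fin k → Fin n}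
    {O : Finset (Fin n)} (hO : O.card = k + 1) (σ : Perm (Fin k)) :
    residue (E ∘ σ) O = 0 ↔ residue E O = 0 := by
  rw [residue_eq_zero_iff hO, residue_eq_zero_iff hO]
  have : ∀ t, (Finset.univ.filter fun l => t ≤ (E ∘ σ) l).card =
      (Finset.univ.filter fun l => t ≤ E l).card := by
    intro t
    rw [Finset.card_filter, Finset.card_filter]
    exact Equiv.sum_comp σ fun l => if t ≤ E l then 1 else 0
  simp only [this]

/-- Otherwise cyclist `m`, who parks before `l`, would have ridden past the space `p l` while it was
free. -/
lemma ParksLinearly.nested {n k : ℕ} {E p : Fin k → Fin n} {O : Finset (Fin n)}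
    (h : ParksLinearly E O p) (hi : Function.Injective p) {l m : Fin k} (hlm : l < m) :
    p l ≤ E m ∨ p m < p l := by
  by_contra! hc
  obtain ⟨m', hm, he⟩ := (h m).2.2 (p l) (h l).1 hc.1
    (lt_of_le_of_ne hc.2 fun he => hlm.ne (hi he))
  exact absurd (hi he) (hlm.trans hm).ne

lemma injective_of_nested {n k : ℕ} {E p : Fin k → Fin n} (hlt : ∀ l, E l < p l)
    (h : ∀ l m, l < m → p l ≤ E m ∨ p m < p l) : Function.Injective p := by
  have : ∀ l m, l < m → p l ≠ p m := fun l m hlm => by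
    rcases h l m hlm with h | h
    · exact (h.trans_lt (hlt m)).ne
    · exact h.ne'
  intro l m he
  by_contra hne
  rcases lt_or_gt_of_ne hne with h | h
  · exact this l m h he
  · exact this m l h he.symm

lemma parksLinearly_of_nested {n k : ℕ} [NeZero n] {E p : Fin k → Fin n}
    (hlt : ∀ l, E l < p l) (h : ∀ l m, l < m → p l ≤ E m ∨ p m < p l) :
    ParksLinearly E (insert 0 (Finset.univ.image p)) p := by
  refine fun l => ⟨by simp, hlt l, fun b hb h1 h2 => ?_⟩
  rcases Finset.mem_insert.1 hb with rfl | hb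
  · exact absurd h1 (not_lt.2 (Fin.zero_le _))
  · obtain ⟨m, -, rfl⟩ := Finset.mem_image.1 hb
    refine ⟨m, ?_, rfl⟩
    by_contra hml
    rcases lt_or_eq_of_le (not_lt.1 hml) with hml | rfl
    · rcases h m l hml with h | h
      · exact absurd h1 (not_lt.2 h)
      · exact lt_asymm h h2
    · exact lt_irrefl _ h2

/-! ### The shift -/

lemma firstOpen_shift {n : ℕ} (m : ℤ) (O : Finset (Fin n)) (e : Fin n) :
    firstOpen (O.map (finRotate n ^ m).toEmbedding) ((finRotate n ^ m) e) =
      (finRotate n ^ m) (firstOpen O e) := by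
  have hcomm : ∀ s : ℕ, (finRotate n ^ s) ((finRotate n ^ m) e) =
      (finRotate n ^ m) ((finRotate n ^ s) e) := fun s => by
    rw [← Perm.mul_apply, ← Perm.mul_apply, ← zpow_natCast, ← zpow_add, ← zpow_add, add_comm]
  rw [firstOpen, hcomm, firstOpen]
  congr 4
  ext s
  rw [Set.mem_ofPred_eq, Set.mem_ofPred_eq, hcomm]
  simp

lemma parking_shift {n k : ℕ} (m : ℤ) (E : Fin k → Fin n) (O : Finset (Fin n)) (l : Fin k) :
    parking (fun l => (finRotate n ^ m) (E l)) (O.map (finRotate n ^ m).toEmbedding) l =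
      (finRotate n ^ m) (parking E O l) := by
  induction k generalizing O with
  | zero => exact l.elim0
  | succ k ih =>
    induction l using Fin.lastCases with
    | last => rw [parking_last, parking_last, firstOpen_shift]
    | cast l =>
      rw [parking_castSucc, parking_castSucc, firstOpen_shift, ← ih]
      congr 1
      ext x
      simp

lemma residue_shift {n k : ℕ} [NeZero n] (m : ℤ) (x : Data n k) :
    residue (shift m x).1 (shift m x).2.1 = (finRotate n ^ m) (residue x.1 x.2.1) := by
  rw [residue_eq_iff (shift m x).2.2]
  obtain ⟨h1, h2⟩ := (residue_eq_iff x.2.2).1 (rfl : residue x.1 x.2.1 = _)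
  refine ⟨Finset.mem_map_of_mem _ h1, fun l hl => ?_⟩
  simp only [shift] at hl
  rw [parking_shift] at hl
  exact h2 l ((finRotate n ^ m).injective hl)

lemma shift_shift {n k : ℕ} (a b : ℤ) (x : Data n k) : shift a (shift b x) = shift (a + b) x := by
  refine Prod.ext (funext fun l => ?_) (Subtype.ext ?_)
  · simp [shift, zpow_add]
  · simp only [shift, zpow_add, Finset.map_map]
    rfl

lemma shift_congr {n k : ℕ} {a b : ℤ} (h : finRotate n ^ a = finRotate n ^ b) (x : Data n k) :
    shift a x = shift b x := by
  simp only [shift, h]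

lemma shift_zero {n k : ℕ} (x : Data n k) : shift 0 x = x := by
  refine Prod.ext (funext fun l => ?_) (Subtype.ext ?_)
  · simp [shift]
  · simp only [shift, zpow_zero]
    exact Finset.map_refl

lemma finRotate_pow_apply_zero {n : ℕ} [NeZero n] (x : Fin n) :
    (finRotate n ^ ((x : ℕ) : ℤ)) 0 = x := by
  rw [zpow_natCast, Fin.ext_iff, finRotate_pow_val, Fin.val_zero, zero_add, Nat.mod_eq_of_lt x.2]

/-- Powers of the long cycle commute and move `0` to every point, so such a power is determined by
the image of `0`. -/
lemma finRotate_zpow_eq {n : ℕ} [NeZero n] {a b : ℤ}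
    (h : (finRotate n ^ a) 0 = (finRotate n ^ b) 0) : finRotate n ^ a = finRotate n ^ b := by
  ext1 x
  rw [← finRotate_pow_apply_zero x, ← Perm.mul_apply, ← Perm.mul_apply, ← zpow_add, ← zpow_add,
    add_comm, add_comm b, zpow_add, zpow_add, Perm.mul_apply, Perm.mul_apply, h]

lemma residue_normalize {n k : ℕ} [NeZero n] (x : Data n k) :
    residue (normalize x).1 (normalize x).2.1 = 0 := by
  rw [normalize, residue_shift, zpow_neg, Perm.inv_eq_iff_eq, finRotate_pow_apply_zero]

lemma normalize_eq_self {n k : ℕ} [NeZero n] {x : Data n k} (h : residue x.1 x.2.1 = 0) :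
    normalize x = x := by
  rw [normalize, h]
  simpa using shift_zero x

lemma shift_residue_normalize {n k : ℕ} [NeZero n] (x : Data n k) :
    shift ((residue x.1 x.2.1 : ℕ) : ℤ) (normalize x) = x := by
  rw [normalize, shift_shift, add_neg_cancel, shift_zero]

lemma normalize_shift {n k : ℕ} [NeZero n] (m : ℤ) (x : Data n k) :
    normalize (shift m x) = normalize x := by
  rw [normalize, residue_shift, shift_shift, normalize]
  apply shift_congr
  set r := residue x.1 x.2.1
  have h1 := finRotate_pow_apply_zero r
  have h2 := finRotate_pow_apply_zero ((finRotate n ^ m) r)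
  set r' := (finRotate n ^ m) r with hr'
  have h3 : finRotate n ^ (((r' : ℕ) : ℤ)) = finRotate n ^ (m + ((r : ℕ) : ℤ)) := by
    apply finRotate_zpow_eq
    rw [h2, zpow_add, Perm.mul_apply, h1]
  rw [zpow_add, zpow_neg, h3, zpow_add, zpow_neg]
  group

lemma normalize_eq_iff {n k : ℕ} [NeZero n] (x y : Data n k) :
    normalize x = normalize y ↔ ∃ m : ℤ, y = shift m x := by
  constructor
  · intro h
    refine ⟨((residue y.1 y.2.1 : ℕ) : ℤ) + -((residue x.1 x.2.1 : ℕ) : ℤ), ?_⟩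
    rw [← shift_shift]
    change y = shift _ (normalize x)
    rw [h, shift_residue_normalize]
  · rintro ⟨m, rfl⟩
    exact (normalize_shift m x).symm

/-! ### The map -/

lemma residue_sorted {n k : ℕ} [NeZero n] (x : Data n k) :
    residue (sorted x) (normalize x).2.1 = 0 :=
  (residue_comp_perm_eq_zero_iff (normalize x).2.2 _).2 (residue_normalize x)

lemma monotone_sorted {n k : ℕ} [NeZero n] (x : Data n k) : Monotone (sorted x) :=
  Tuple.monotone_sort _

lemma parksLinearly_sorted {n k : ℕ} [NeZero n] (x : Data n k) :
    ParksLinearly (sorted x) (normalize x).2.1 (parking (sorted x) (normalize x).2.1) := by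
  obtain ⟨h1, h2⟩ := (residue_eq_iff (normalize x).2.2).1 (residue_sorted x)
  exact parksLinearly_parking h1 h2

lemma low_sortedPath {n k : ℕ} [NeZero n] (x : Data n k) (l : Fin k) :
    low (sortedPath x l) = sorted x l :=
  low_swap (parksLinearly_sorted x l).2.1

lemma high_sortedPath {n k : ℕ} [NeZero n] (x : Data n k) (l : Fin k) :
    high (sortedPath x l) = parking (sorted x) (normalize x).2.1 l :=
  high_swap (parksLinearly_sorted x l).2.1

lemma sortedPath_mem {n k : ℕ} [NeZero n] (x : Data n k) : sortedPath x ∈ prefixes n k := by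
  rw [mem_prefixes_iff_nested]
  · refine ⟨fun l => ⟨_, _, (parksLinearly_sorted x l).2.1.ne, rfl⟩, fun l m hlm => ?_⟩
    rw [Nested, high_sortedPath, high_sortedPath, low_sortedPath]
    exact (parksLinearly_sorted x).nested
      (parking_mem_injective _ _ (normalize x).2.2).2 hlm
  · simpa only [low_sortedPath] using monotone_sorted x

lemma Gamma_mem {n k : ℕ} [NeZero n] (x : Data n k) : Gamma x ∈ prefixes n k :=
  permAct_mem _ (sortedPath_mem x)

lemma low_Gamma {n k : ℕ} [NeZero n] (x : Data n k) (i : Fin k) :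
    low (Gamma x i) = (normalize x).1 i := by
  rw [Gamma, low_permAct _ (sortedPath_mem x).1, low_sortedPath, sorted]
  simp

/-- Both paths arise from `sortedPath x` and have `Ã` as smaller ends, so they agree. -/
lemma Gamma_eq_permAct {n k : ℕ} [NeZero n] (x : Data n k) (σ : Perm (Fin k))
    (h : permuteSeq σ (normalize x).1 = sorted x) : Gamma x = permAct σ⁻¹ (sortedPath x) := by
  refine permAct_congr (sortedPath_mem x).1 fun i => ?_
  rw [← low_permAct _ (sortedPath_mem x).1]
  change low (Gamma x i) = _
  rw [low_Gamma, low_sortedPath, ← h]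
  simp [permuteSeq]

lemma normalize_set_eq {n k : ℕ} [NeZero n] (x : Data n k) :
    (normalize x).2.1 =
      insert 0 (Finset.univ.image (parking (sorted x) (normalize x).2.1)) := by
  have h := vacant_eq (sorted x) _ (normalize x).2.2
  rw [residue_sorted, vacant] at h
  have hsub : Finset.univ.image (parking (sorted x) (normalize x).2.1) ⊆ (normalize x).2.1 := by
    intro y hy
    obtain ⟨l, -, rfl⟩ := Finset.mem_image.1 hy
    exact (parksLinearly_sorted x l).1
  conv_lhs => rw [← Finset.sdiff_union_of_subset hsub, h]
  rfl

lemma Gamma_eq_iff {n k : ℕ} [NeZero n] (x y : Data n k) :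
    Gamma x = Gamma y ↔ normalize x = normalize y := by
  constructor
  · intro h
    have hA : (normalize x).1 = (normalize y).1 := by
      funext i
      rw [← low_Gamma, ← low_Gamma, h]
    have hback : ∀ z : Data n k,
        permAct (Tuple.sort (normalize z).1)⁻¹ (Gamma z) = sortedPath z := fun z => by
      rw [Gamma, ← permAct_mul _ _ (sortedPath_mem z).1, inv_mul_cancel,
        permAct_one (sortedPath_mem z).1]
    -- The smaller ends determine `Ã`, hence the sorting permutation, which can therefore be undone
    -- on both sides alike.
    have hp : sortedPath x = sortedPath y := by rw [← hback, ← hback, hA, h]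
    refine Prod.ext hA (Subtype.ext ?_)
    rw [normalize_set_eq x, normalize_set_eq y]
    congr 2
    funext l
    rw [← high_sortedPath, ← high_sortedPath, hp]
  · intro h
    have hp : sortedPath x = sortedPath y := by
      funext l
      simp only [sortedPath, sorted, h]
    rw [Gamma, Gamma, hp, h]

lemma exists_Gamma_eq {n k : ℕ} [NeZero n] {γ : Fin k → Perm (Fin n)} (hγ : γ ∈ prefixes n k) :
    ∃ x : Data n k, Gamma x = γ := by
  set A : Fin k → Fin n := fun l => low (γ l) with hA
  set δ := permAct (Tuple.sort A)⁻¹ γ with hδ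
  have hδm : δ ∈ prefixes n k := permAct_mem _ hγ
  have hlow : ∀ l, low (δ l) = A (Tuple.sort A l) := fun l => by
    rw [hδ, low_permAct _ hγ.1, inv_inv]
  have hmono : Monotone fun l => low (δ l) := by
    simp only [hlow]
    exact Tuple.monotone_sort A
  obtain ⟨-, hN⟩ := (mem_prefixes_iff_nested hmono).1 hδm
  have hlt : ∀ l, low (δ l) < high (δ l) := fun l => low_lt_high (hδm.1 l)
  set J : Fin k → Fin n := fun l => high (δ l)
  have hinj : Function.Injective J := injective_of_nested hlt hN
  have hJ0 : ∀ l, J l ≠ 0 := fun l => ((Fin.zero_le _).trans_lt (hlt l)).ne'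
  -- The larger ends are the occupied spaces; `0` is never a larger end and becomes the vacant one.
  set O : Finset (Fin n) := insert 0 (Finset.univ.image J) with hO
  have hcard : O.card = k + 1 := by
    rw [hO, Finset.card_insert_of_notMem (by simp [hJ0]), Finset.card_image_of_injective _ hinj,
      Finset.card_univ, Fintype.card_fin]
  have hpark : parking (A ∘ Tuple.sort A) O = J := by
    have := (parksLinearly_of_nested hlt hN).parking_eq hinj
    simp only [hlow] at this
    exact this
  have hres : residue A O = 0 := by
    rw [← residue_comp_perm_eq_zero_iff hcard (Tuple.sort A), residue_eq_iff hcard, hpark]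
    exact ⟨Finset.mem_insert_self _ _, hJ0⟩
  let x : Data n k := (A, ⟨O, hcard⟩)
  have hx : normalize x = x := normalize_eq_self hres
  have hsp : sortedPath x = δ := by
    funext l
    rw [eq_swap_low_high (hδm.1 l), sortedPath, sorted, hx, hlow]
    change swap _ (parking (A ∘ Tuple.sort A) O l) = _
    rw [hpark]
    rfl
  refine ⟨x, ?_⟩
  rw [Gamma, hsp, hx]
  change permAct (Tuple.sort A) δ = γ
  rw [hδ, ← permAct_mul _ _ hγ.1, mul_inv_cancel, permAct_one hγ.1]

lemma ncard_fibre {n k : ℕ} [NeZero n] {γ : Fin k → Perm (Fin n)} (hγ : γ ∈ prefixes n k) :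
    {x : Data n k | Gamma x = γ}.ncard = n := by
  obtain ⟨x, rfl⟩ := exists_Gamma_eq hγ
  have heq : {y : Data n k | Gamma y = Gamma x} =
      Set.range fun r : Fin n => shift ((r : ℕ) : ℤ) (normalize x) := by
    ext y
    rw [Set.mem_ofPred_eq, Gamma_eq_iff]
    constructor
    · intro h
      exact ⟨residue y.1 y.2.1, by simp only [← h, shift_residue_normalize]⟩
    · rintro ⟨r, rfl⟩
      rw [normalize_shift, normalize_eq_self (residue_normalize x)]
  rw [heq, ← Set.image_univ, Set.ncard_image_of_injective, Set.ncard_univ, Nat.card_fin]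
  -- The shift by `r` of a pair with residue `0` has residue `r`, so the shifts by different `r`
  -- differ.
  intro r s hrs
  have h := residue_shift ((r : ℕ) : ℤ) (normalize x)
  have h' := residue_shift ((s : ℕ) : ℤ) (normalize x)
  rw [residue_normalize, finRotate_pow_apply_zero] at h h'
  rw [← h, ← h']
  simp only at hrs
  rw [hrs]

lemma card_prefixes (n k : ℕ) [NeZero n] :
    n * (prefixes n k).ncard = n ^ k * n.choose (k + 1) := by
  classical
  have hfin : (prefixes n k).Finite := Set.toFinite _
  have h := Finset.card_eq_sum_card_fiberwise (s := (Finset.univ : Finset (Data n k)))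
    (t := hfin.toFinset) (f := Gamma) (fun x _ => by simpa using Gamma_mem x)
  rw [Finset.sum_const_nat (m := n)] at h
  · rw [Set.ncard_eq_toFinset_card _ hfin, mul_comm, ← h, Finset.card_univ, Fintype.card_prod]
    simp [Fintype.card_finset_len]
  · intro γ hγ
    refine Eq.trans ?_ (ncard_fibre (hfin.mem_toFinset.1 hγ))
    rw [← Set.ncard_coe_finset]
    congr 1
    ext x
    simp

end CyclePrefix

theorem mainTheorem1 (n k : ℕ) [NeZero n] :
    -- the Coxeter operations define an action of the symmetric group on `Σ_n(k)`
    ((∀ (σ : Equiv.Perm (Fin k)), ∀ γ ∈ CyclePrefix.prefixes n k,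
        CyclePrefix.permAct σ γ ∈ CyclePrefix.prefixes n k) ∧
      (∀ γ ∈ CyclePrefix.prefixes n k, CyclePrefix.permAct 1 γ = γ) ∧
      (∀ (σ τ : Equiv.Perm (Fin k)), ∀ γ ∈ CyclePrefix.prefixes n k,
        CyclePrefix.permAct (σ * τ) γ = CyclePrefix.permAct σ (CyclePrefix.permAct τ γ)) ∧
      (∀ (l : Fin (k - 1)), ∀ γ ∈ CyclePrefix.prefixes n k,
        CyclePrefix.permAct (CyclePrefix.coxeterGen l) γ = CyclePrefix.genAct l γ)) ∧
    -- `Γ_{n,k}` does not depend on the choice of the permutation `σ` with `σ · Ã = I`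
    (∀ (x : CyclePrefix.Data n k) (σ : Equiv.Perm (Fin k)),
      CyclePrefix.permuteSeq σ (CyclePrefix.normalize x).1 = CyclePrefix.sorted x →
        CyclePrefix.Gamma x = CyclePrefix.permAct σ⁻¹ (CyclePrefix.sortedPath x)) ∧
    -- `Γ_{n,k}` is a surjection onto `Σ_n(k)`
    (∀ x : CyclePrefix.Data n k, CyclePrefix.Gamma x ∈ CyclePrefix.prefixes n k) ∧
    (∀ γ ∈ CyclePrefix.prefixes n k, ∃ x : CyclePrefix.Data n k, CyclePrefix.Gamma x = γ) ∧
    -- its fibres are the orbits of the shift modulo `n`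
    (∀ x y : CyclePrefix.Data n k,
      CyclePrefix.Gamma x = CyclePrefix.Gamma y ↔ ∃ m : ℤ, y = CyclePrefix.shift m x) ∧
    -- each of them has `n` elements
    (∀ γ ∈ CyclePrefix.prefixes n k,
      {x : CyclePrefix.Data n k | CyclePrefix.Gamma x = γ}.ncard = n) ∧
    -- the number of elements of `Σ_n(k)`
    ((CyclePrefix.prefixes n k).ncard : ℚ) =
      (n : ℚ) ^ ((k : ℤ) - 1) * (n.choose (k + 1) : ℚ) := by
  refine ⟨⟨fun σ γ hγ => CyclePrefix.permAct_mem σ hγ, fun γ hγ => CyclePrefix.permAct_one hγ.1,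
    fun σ τ γ hγ => CyclePrefix.permAct_mul σ τ hγ.1,
    fun l γ hγ => CyclePrefix.permAct_coxeterGen l hγ.1⟩,
    CyclePrefix.Gamma_eq_permAct, CyclePrefix.Gamma_mem, fun γ => CyclePrefix.exists_Gamma_eq,
    fun x y => (CyclePrefix.Gamma_eq_iff x y).trans (CyclePrefix.normalize_eq_iff x y),
    fun γ => CyclePrefix.ncard_fibre, ?_⟩
  -- The division by `n` takes place in `ℚ`, which covers the exponent `-1` for `k = 0`.
  have h := congrArg (Nat.cast (R := ℚ)) (CyclePrefix.card_prefixes n k)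
  push_cast at h
  have hn : (n : ℚ) ≠ 0 := Nat.cast_ne_zero.2 (NeZero.ne n)
  rw [zpow_sub_one₀ hn, zpow_natCast, mul_right_comm, ← h, mul_right_comm, mul_inv_cancel₀ hn,
    one_mul]
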